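/- Theorem. There is an absolute constant $C>0$ such that the following holds. Let $n\ge 1$ and $m$ be integers, let $\mathcal X=\mathcal X^{\mathrm{pub}}\times\mathcal X^{\mathrm{priv}}$ with $\mathcal X^{\mathrm{priv}}$ finite of size $k$, and let $G,\mu,\lambda>0$. For each $i\in[m]$ let $\mathcal W_i\subseteq\mathbb R^{d_i}$ be a nonempty closed convex set and $\ell_i:\mathcal W_i\times\mathcal X\to\mathbb R$ a loss function such that, for every $x\in\mathcal X$, the function $\ell=\ell_i(\cdot;x)$ is - $G$-Lipschitz on $\mathcal W_i$: $|\ell(w)-\ell(w')|\le G\|w-w'\|_2$ for all $w,w'\in\mathcal W_i$; and - differentiable on $\mathcal W_i$ (relative to $\mathcal W_i$) with a gradient field $\nabla\ell:\mathcal W_i\to\mathbb R^{d_i}$ for which it is $\mu$-strongly convex, i.e. $\ell(w)\ge\ell(w')+\langle\nabla\ell(w'),w-w'\rangle+\frac{\mu}{2}\|w-w'\|_2^2$ for all $w,w'\in\mathcal W_i$, and $\lambda$-smooth, i.e. $\|\nabla\ell(w)-\nabla\ell(w')\|_2\le\lambda\|w-w'\|_2$ for all $w,w'\in\mathcal W_i$.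 For a dataset $D=(x_1,\dots,x_n)\in\mathcal X^n$ put $\mathcal L_i(w;D)=\frac1n\sum_{j=1}^n\ell_i(w;x_j)$. Call two datasets neighbors if all their public parts agree and their private parts differ in at most one example. A randomized algorithm $\mathrm A$ is $(\varepsilon,\delta)$-semi-sensitive DP if $\Pr[\mathrm A(D)\in S]\le e^{\varepsilon}\Pr[\mathrm A(D')\in S]+\delta$ for all neighbors $D,D'$ and all measurable sets $S$ of outputs. Then for every $\delta\in(0,1/2)$ and $\varepsilon\in(0,\ln(1/\delta))$ there is an $(\varepsilon,\delta)$-semi-sensitive DP algorithm $\mathrm A$ which, on input $D\in\mathcal X^n$, outputs $(w_1,\dots,w_m)\in\mathcal W_1\times\dots\times\mathcal W_m$ such that for every $D\in\mathcal X^n$ and every $i\in[m]$ $$\mathbb E\Big[\mathcal L_i(w_i;D)-\min_{w'\in\mathcal W_i}\mathcal L_i(w';D)\Big]\le C\cdot\frac{G^2}{\mu}\cdot\frac{\sqrt{\ln k\cdot\ln(1/\delta)}\cdot\Big(\ln\max\{2,\tfrac{mn\lambda}{\mu}\}+\ln\max\{1,\ln\tfrac{G}{\mu}\}+\ln\ln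 k+\ln\max\{1,\tfrac{\sqrt{\ln(1/\delta)}}{\varepsilon}\}\Big)}{\varepsilon n},$$ where for $k=1$ the right-hand side is read as $0$. -/

import Mathlib

open MeasureTheory

noncomputable section

namespace SemiSensitive

/-- A dataset of `n` examples, each with a public (non-sensitive) and a private (sensitive) part. -/
abbrev Dataset (Xpub : Type*) (Xpriv : Type*) (n : ℕ) : Type _ := Fin n → Xpub × Xpriv

/-- Two datasets are neighbors if all public parts agree and the private parts differ on at most
one example. -/
def Neighbors {Xpub Xpriv : Type*} {n : ℕ} (D D' : Dataset Xpub Xpriv n) : Prop :=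
  (∀ i, (D i).1 = (D' i).1) ∧ ∃ i', ∀ i, i ≠ i' → (D i).2 = (D' i).2

/-- A randomized algorithm with input a dataset and output in `Ω`, given by its output
distributions. -/
abbrev Mechanism (Xpub : Type*) (Xpriv : Type*) (n : ℕ) (Ω : Type*) [MeasurableSpace Ω] : Type _ :=
  Dataset Xpub Xpriv n → ProbabilityMeasure Ω

/-- `(ε, δ)`-semi-sensitive differential privacy. -/
def IsSemiSensitiveDP {Xpub Xpriv : Type*} {n : ℕ} {Ω : Type*} [MeasurableSpace Ω]
    (ε δ : ℝ) (A : Mechanism Xpub Xpriv n Ω) : Prop :=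
  ∀ D D' : Dataset Xpub Xpriv n, Neighbors D D' → ∀ S : Set Ω, MeasurableSet S →
    (A D : Measure Ω) S ≤ ENNReal.ofReal (Real.exp ε) * (A D' : Measure Ω) S + ENNReal.ofReal δ

/-- `f` is `G`-Lipschitz on `W` for the Euclidean norm. -/
def IsLipschitzLoss {d : ℕ} (G : ℝ) (W : Set (EuclideanSpace ℝ (Fin d)))
    (f : EuclideanSpace ℝ (Fin d) → ℝ) : Prop :=
  ∀ w ∈ W, ∀ w' ∈ W, |f w - f w'| ≤ G * ‖w - w'‖

/-- `g` is a gradient field of `f` on `W`, relative to `W` (only the values of `f` on `W` matter). -/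
def IsGradientOn {d : ℕ} (W : Set (EuclideanSpace ℝ (Fin d)))
    (f : EuclideanSpace ℝ (Fin d) → ℝ)
    (g : EuclideanSpace ℝ (Fin d) → EuclideanSpace ℝ (Fin d)) : Prop :=
  ∀ w ∈ W, HasGradientWithinAt f (g w) W w

/-- `f` is differentiable on `W`, with a gradient field for which it is both `μ`-strongly convex
and `lam`-smooth. -/
def IsStronglyConvexSmooth {d : ℕ} (μ lam : ℝ) (W : Set (EuclideanSpace ℝ (Fin d)))
    (f : EuclideanSpace ℝ (Fin d) → ℝ) : Prop :=
  ∃ g : EuclideanSpace ℝ (Fin d) → EuclideanSpace ℝ (Fin d),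
    IsGradientOn W f g ∧
    (∀ w ∈ W, ∀ w' ∈ W, f w' + inner ℝ (g w') (w - w') + μ / 2 * ‖w - w'‖ ^ 2 ≤ f w) ∧
    (∀ w ∈ W, ∀ w' ∈ W, ‖g w - g w'‖ ≤ lam * ‖w - w'‖)

/-- The empirical risk `(1/n) ∑ᵢ ℓ(w; xᵢ)`. -/
def empiricalRisk {Xpub Xpriv : Type*} {n d : ℕ}
    (l : EuclideanSpace ℝ (Fin d) → Xpub × Xpriv → ℝ) (D : Dataset Xpub Xpriv n)
    (w : EuclideanSpace ℝ (Fin d)) : ℝ :=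
  (1 / (n : ℝ)) * ∑ i, l w (D i)

/-- The excess empirical risk of `w` over the domain `W`. -/
def excessRisk {Xpub Xpriv : Type*} {n d : ℕ} (W : Set (EuclideanSpace ℝ (Fin d)))
    (l : EuclideanSpace ℝ (Fin d) → Xpub × Xpriv → ℝ) (D : Dataset Xpub Xpriv n)
    (w : EuclideanSpace ℝ (Fin d)) : ℝ :=
  empiricalRisk l D w - ⨅ w' : W, empiricalRisk l D w'

end SemiSensitive

end

/-! For fixed public parts, the risks depend only on the private vector `y`, so it suffices to run
private multiplicative weights on a product of `n` distributions over the private values, one per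
example. A state `θ` (the log-weights) defines a synthetic risk for every `i`; the query put to the
data is the gradient of the `i`-th risk at the minimizer of that synthetic risk. By first-order
optimality and strong convexity, this minimizer has true excess risk at most `‖gap‖ ^ 2 / (2 * μ)`,
where the gap is the true minus the synthetic gradient (`sub_norm_sq_le`).

Each round selects `i` by the exponential mechanism scored by the gap norm, then releases
independent random signs with mean proportional to the gap. The sign vector is sub-Gaussian with a
dimension-free constant, so an update along it lowers the cross-entropy in expectation by order
`‖gap‖ ^ 2 / G ^ 2`, up to noise (`sum_roundProb_mul_crossEntropy_le`). The cross-entropy starts at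
`log k` and stays nonnegative, so after about `G ^ 2 * log k / α ^ 2` rounds the mean squared gap is
`O(α ^ 2)`, and the average of the minimizers solves all problems. All randomness is finite.

Privacy is tracked by the moments `∑ p * (p / q) ^ a`, which multiply under adaptive composition and
yield `(ε, δ)` by Markov's inequality. Balancing gives `α ^ 2` of order `G ^ 2 * (1 + log m) * √(log
k * log (1/δ)) / (ε * n)`; the logarithmic bracket of the theorem dominates `1 + log m`. -/

noncomputable section

namespace SemiSensitive

/-! ### Finitely supported output laws -/

/-- The measure giving weight `p i` to the point `out i`. -/
def weightedDirac {ι Ω : Type*} [Fintype ι] [MeasurableSpace Ω] (p : ι → ℝ) (out : ι → Ω) :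
    Measure Ω :=
  ∑ i, ENNReal.ofReal (p i) • Measure.dirac (out i)

section weightedDirac

variable {ι Ω : Type*} [Fintype ι] [MeasurableSpace Ω] {p q : ι → ℝ} {out : ι → Ω}

lemma weightedDirac_apply (hp : ∀ i, 0 ≤ p i) {S : Set Ω} (hS : MeasurableSet S) :
    weightedDirac p out S = ENNReal.ofReal (∑ i, S.indicator (fun _ => p i) (out i)) := by
  rw [ENNReal.ofReal_sum_of_nonneg fun i _ => Set.indicator_nonneg (fun _ _ => hp i) _]
  simp only [weightedDirac, Measure.coe_finsetSum, Finset.sum_apply, Measure.smul_apply,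
    smul_eq_mul]
  refine Finset.sum_congr rfl fun i _ => ?_
  rw [Measure.dirac_apply' _ hS]
  by_cases h : out i ∈ S <;> simp [h]

lemma isProbabilityMeasure_weightedDirac (hp : ∀ i, 0 ≤ p i) (hp1 : ∑ i, p i = 1) :
    IsProbabilityMeasure (weightedDirac p out) :=
  ⟨by simp [weightedDirac_apply hp, hp1]⟩

lemma integrable_weightedDirac [MeasurableSingletonClass Ω] (f : Ω → ℝ) :
    Integrable f (weightedDirac p out) := by
  refine integrable_finsetSum_measure.2 fun i _ => ?_
  exact (integrable_dirac (by simp)).smul_measure (by simp)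

lemma integral_weightedDirac [MeasurableSingletonClass Ω] (hp : ∀ i, 0 ≤ p i) (f : Ω → ℝ) :
    ∫ w, f w ∂(weightedDirac p out) = ∑ i, p i * f (out i) := by
  unfold weightedDirac
  rw [integral_finsetSum_measure]
  · simp [hp]
  · exact fun i _ => (integrable_dirac (by simp)).smul_measure (by simp)

end weightedDirac

/-! ### Moments of likelihood ratios -/

/-- Hoeffding's lemma for a finite weighted sum. -/
lemma sum_mul_exp_le {ι : Type*} [Fintype ι] {p x : ι → ℝ} {lo c : ℝ} (hp : ∀ i, 0 ≤ p i)
    (hp1 : ∑ i, p i = 1) (hlo : ∀ i, lo ≤ x i) (hhi : ∀ i, x i ≤ lo + 2 * c) (t : ℝ) :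
    ∑ i, p i * Real.exp (t * x i) ≤ Real.exp (t * ∑ i, p i * x i + t ^ 2 * c ^ 2 / 2) := by
  have hprob := isProbabilityMeasure_weightedDirac (out := x) hp hp1
  have hb : ∀ᵐ w ∂(weightedDirac p x), id w ∈ Set.Icc lo (lo + 2 * c) := by
    rw [ae_iff]
    change weightedDirac p x (Set.Icc lo (lo + 2 * c))ᶜ = 0
    rw [weightedDirac_apply hp measurableSet_Icc.compl]
    simp [hlo, hhi]
  have h := (ProbabilityTheory.hasSubgaussianMGF_of_mem_Icc (μ := weightedDirac p x)
    measurable_id.aemeasurable hb).mgf_le t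
  rw [ProbabilityTheory.mgf, integral_weightedDirac hp, integral_weightedDirac hp] at h
  simp only [id] at h
  set M := ∑ i, p i * x i
  have e : ∑ i, p i * Real.exp (t * x i)
      = Real.exp (t * M) * ∑ i, p i * Real.exp (t * (x i - M)) := by
    rw [Finset.mul_sum]
    refine Finset.sum_congr rfl fun i _ => ?_
    rw [mul_left_comm, ← Real.exp_add]
    ring_nf
  rw [e, Real.exp_add]
  refine mul_le_mul_of_nonneg_left (h.trans (Real.exp_le_exp.2 (le_of_eq ?_))) (Real.exp_nonneg _)
  push_cast
  rw [show lo + 2 * c - lo = 2 * c by ring, Real.norm_eq_abs, div_pow, sq_abs]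
  ring

/-- Jensen's inequality for the logarithm. -/
lemma sum_mul_log_le {ι : Type*} [Fintype ι] {p x : ι → ℝ} {B : ℝ} (hp : ∀ i, 0 ≤ p i)
    (hp1 : ∑ i, p i = 1) (hx : ∀ i, 0 < x i) (h : ∑ i, p i * x i ≤ Real.exp B) :
    ∑ i, p i * Real.log (x i) ≤ B := by
  -- The logarithm lies below its tangent at `exp B`.
  have key : ∀ i, p i * Real.log (x i) ≤ p i * x i * Real.exp (-B) + p i * (B - 1) := by
    intro i
    have h1 := Real.log_le_sub_one_of_pos (mul_pos (hx i) (Real.exp_pos (-B)))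
    rw [Real.log_mul (hx i).ne' (Real.exp_ne_zero _), Real.log_exp] at h1
    nlinarith [mul_le_mul_of_nonneg_left h1 (hp i)]
  calc ∑ i, p i * Real.log (x i) ≤ ∑ i, (p i * x i * Real.exp (-B) + p i * (B - 1)) :=
        Finset.sum_le_sum fun i _ => key i
    _ = (∑ i, p i * x i) * Real.exp (-B) + (B - 1) := by
        rw [Finset.sum_add_distrib, ← Finset.sum_mul, ← Finset.sum_mul, hp1, one_mul]
    _ ≤ Real.exp B * Real.exp (-B) + (B - 1) := by
        gcongr
    _ = B := by rw [← Real.exp_add]; simp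

/-- The divergence bound of a `c`-bounded range log-likelihood ratio: the moments of the
likelihood ratio `p / q` are at most those of a Gaussian shift of size `c`. -/
lemma sum_mul_div_rpow_le {ι : Type*} [Fintype ι] {p q : ι → ℝ} {lo c a : ℝ}
    (hp : ∀ i, 0 < p i) (hq : ∀ i, 0 < q i) (hp1 : ∑ i, p i = 1) (hq1 : ∑ i, q i = 1)
    (hlo : ∀ i, lo ≤ Real.log (p i / q i)) (hhi : ∀ i, Real.log (p i / q i) ≤ lo + 2 * c)
    (ha : 0 ≤ a) :
    ∑ i, p i * (p i / q i) ^ a ≤ Real.exp ((a ^ 2 + a) * (c ^ 2 / 2)) := by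
  have H := sum_mul_exp_le (fun i => (hp i).le) hp1 hlo hhi
  have h1 : ∑ i, p i * Real.exp (-1 * Real.log (p i / q i)) = 1 := by
    refine Eq.trans (Finset.sum_congr rfl fun i _ => ?_) hq1
    rw [neg_one_mul, Real.exp_neg, Real.exp_log (div_pos (hp i) (hq i))]
    field_simp [(hp i).ne']
  -- Hoeffding at `t = -1`, where the left side is `∑ q = 1`, bounds the mean log-ratio (the KL
  -- divergence) by `c ^ 2 / 2`.
  have h2 := mul_nonneg ha (Real.one_le_exp_iff.1 (h1 ▸ H (-1)))
  calc ∑ i, p i * (p i / q i) ^ a = ∑ i, p i * Real.exp (a * Real.log (p i / q i)) := by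
        refine Finset.sum_congr rfl fun i _ => ?_
        rw [Real.rpow_def_of_pos (div_pos (hp i) (hq i)), mul_comm a]
    _ ≤ _ := (H a).trans (Real.exp_le_exp.2 (by linarith))

/-- Conversion of a bound on the moments of the likelihood ratio into an
`(ε, δ)`-indistinguishability bound. -/
lemma weightedDirac_le_of_rpow {ι Ω : Type*} [Fintype ι] [MeasurableSpace Ω] {p q : ι → ℝ}
    {out : ι → Ω} {ε δ a : ℝ} (hp : ∀ i, 0 < p i) (hq : ∀ i, 0 < q i) (ha : 0 ≤ a)
    (h : ∑ i, p i * (p i / q i) ^ a ≤ δ * Real.exp (a * ε)) {S : Set Ω} (hS : MeasurableSet S) :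
    weightedDirac p out S
      ≤ ENNReal.ofReal (Real.exp ε) * weightedDirac q out S + ENNReal.ofReal δ := by
  have hr : ∀ i, 0 ≤ p i * (p i / q i) ^ a := fun i =>
    mul_nonneg (hp i).le (Real.rpow_nonneg (div_pos (hp i) (hq i)).le _)
  have hδ : 0 ≤ δ := by
    have := (Finset.sum_nonneg fun i _ => hr i).trans h
    exact nonneg_of_mul_nonneg_left this (Real.exp_pos _)
  rw [weightedDirac_apply (fun i => (hp i).le) hS, weightedDirac_apply (fun i => (hq i).le) hS,
    ← ENNReal.ofReal_mul (Real.exp_nonneg _), ← ENNReal.ofReal_add _ hδ]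
  swap
  · exact mul_nonneg (Real.exp_nonneg _)
      (Finset.sum_nonneg fun i _ => Set.indicator_nonneg (fun _ _ => (hq i).le) _)
  refine ENNReal.ofReal_le_ofReal ?_
  -- Where `p` exceeds `exp ε * q`, the factor `(p / q) ^ a * exp (-(a * ε))` is at least one:
  -- Markov's inequality, pointwise.
  have key : ∀ i, S.indicator (fun _ => p i) (out i)
      ≤ Real.exp ε * S.indicator (fun _ => q i) (out i)
        + p i * (p i / q i) ^ a * Real.exp (-(a * ε)) := by
    intro i
    have h0 : 0 ≤ p i * (p i / q i) ^ a * Real.exp (-(a * ε)) :=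
      mul_nonneg (hr i) (Real.exp_nonneg _)
    by_cases hi : out i ∈ S
    · simp only [Set.indicator_of_mem hi]
      by_cases hle : p i ≤ Real.exp ε * q i
      · linarith
      · have h1 : Real.exp ε ≤ p i / q i := by
          rw [le_div_iff₀ (hq i)]; exact (not_le.1 hle).le
        have h2 : Real.exp (a * ε) ≤ (p i / q i) ^ a := by
          rw [mul_comm, Real.exp_mul]
          exact Real.rpow_le_rpow (Real.exp_nonneg _) h1 ha
        have h3 : 1 ≤ (p i / q i) ^ a * Real.exp (-(a * ε)) := by
          rw [Real.exp_neg, ← div_eq_mul_inv, le_div_iff₀ (Real.exp_pos _), one_mul]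
          exact h2
        have := mul_le_mul_of_nonneg_left h3 (hp i).le
        have := mul_pos (Real.exp_pos ε) (hq i)
        linarith
    · simp only [Set.indicator_of_notMem hi]
      linarith
  calc _ ≤ ∑ i, (Real.exp ε * S.indicator (fun _ => q i) (out i)
        + p i * (p i / q i) ^ a * Real.exp (-(a * ε))) := Finset.sum_le_sum fun i _ => key i
    _ = Real.exp ε * ∑ i, S.indicator (fun _ => q i) (out i)
        + (∑ i, p i * (p i / q i) ^ a) * Real.exp (-(a * ε)) := by
        rw [Finset.sum_add_distrib, Finset.mul_sum, Finset.sum_mul]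
    _ ≤ Real.exp ε * ∑ i, S.indicator (fun _ => q i) (out i)
        + δ * Real.exp (a * ε) * Real.exp (-(a * ε)) := by gcongr
    _ = _ := by rw [mul_assoc, ← Real.exp_add]; simp

/-! ### Adaptive composition along transcripts -/

section Adaptive

variable {S Ω : Type*} (upd : S → Ω → S)

/-- The probability of a transcript of `T` rounds started in the state `s`. -/
def transcriptProb (K : S → Ω → ℝ) : (T : ℕ) → S → (Fin T → Ω) → ℝ
  | 0, _, _ => 1
  | T + 1, s, ω => K s (ω 0) * transcriptProb K T (upd s (ω 0)) (Fin.tail ω)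

/-- The state at the beginning of each of the `T` rounds of a transcript started in `s`. -/
def transcriptState : (T : ℕ) → S → (Fin T → Ω) → Fin T → S
  | 0, s, _ => fun _ => s
  | T + 1, s, ω => Fin.cons s (transcriptState T (upd s (ω 0)) (Fin.tail ω))

variable {upd}

lemma sum_fin_succ_pi [Fintype Ω] {T : ℕ} (f : Ω → (Fin T → Ω) → ℝ) :
    ∑ ω : Fin (T + 1) → Ω, f (ω 0) (Fin.tail ω) = ∑ a, ∑ ω, f a ω := by
  rw [← Fintype.sum_prod_type']
  exact (Fintype.sum_equiv (Fin.consEquiv fun _ : Fin (T + 1) => Ω) _ _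
    (fun x => by simp [Fin.consEquiv])).symm

lemma transcriptProb_pos {K : S → Ω → ℝ} (hK : ∀ s a, 0 < K s a) :
    ∀ (T : ℕ) (s : S) (ω : Fin T → Ω), 0 < transcriptProb upd K T s ω
  | 0, _, _ => one_pos
  | T + 1, _, _ => mul_pos (hK _ _) (transcriptProb_pos hK T _ _)

lemma sum_transcriptProb [Fintype Ω] {K : S → Ω → ℝ} (hK1 : ∀ s, ∑ a, K s a = 1) :
    ∀ (T : ℕ) (s : S), ∑ ω, transcriptProb upd K T s ω = 1
  | 0, _ => by simp [transcriptProb]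
  | T + 1, s => by
    simp only [transcriptProb]
    rw [sum_fin_succ_pi fun a ω => K s a * transcriptProb upd K T (upd s a) ω]
    simp [← Finset.mul_sum, sum_transcriptProb hK1 T, hK1]

variable [Fintype Ω]

/-- Adaptive composition of bounds on the moments of the likelihood ratio. -/
lemma sum_transcriptProb_div_rpow_le {K K' : S → Ω → ℝ} (hK : ∀ s a, 0 < K s a)
    (hK' : ∀ s a, 0 < K' s a) {a B : ℝ}
    (h : ∀ s, ∑ x, K s x * (K s x / K' s x) ^ a ≤ Real.exp B) :
    ∀ (T : ℕ) (s : S), ∑ ω, transcriptProb upd K T s ω *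
      (transcriptProb upd K T s ω / transcriptProb upd K' T s ω) ^ a ≤ Real.exp (T * B)
  | 0, _ => by simp [transcriptProb]
  | T + 1, s => by
    simp only [transcriptProb]
    rw [sum_fin_succ_pi fun x ω => K s x * transcriptProb upd K T (upd s x) ω *
      (K s x * transcriptProb upd K T (upd s x) ω /
        (K' s x * transcriptProb upd K' T (upd s x) ω)) ^ a]
    calc _ = ∑ x, K s x * (K s x / K' s x) ^ a * ∑ ω, transcriptProb upd K T (upd s x) ω *
          (transcriptProb upd K T (upd s x) ω / transcriptProb upd K' T (upd s x) ω) ^ a := by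
          refine Finset.sum_congr rfl fun x _ => ?_
          rw [Finset.mul_sum]
          refine Finset.sum_congr rfl fun ω _ => ?_
          rw [mul_div_mul_comm, Real.mul_rpow (div_pos (hK _ _) (hK' _ _)).le
            (div_pos (transcriptProb_pos hK _ _ _) (transcriptProb_pos hK' _ _ _)).le]
          ring
      _ ≤ ∑ x, K s x * (K s x / K' s x) ^ a * Real.exp (T * B) := by
          refine Finset.sum_le_sum fun x _ => mul_le_mul_of_nonneg_left
            (sum_transcriptProb_div_rpow_le hK hK' h T _) ?_
          exact mul_nonneg (hK _ _).le (Real.rpow_nonneg (div_pos (hK _ _) (hK' _ _)).le _)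
      _ ≤ Real.exp B * Real.exp (T * B) := by
          rw [← Finset.sum_mul]
          exact mul_le_mul_of_nonneg_right (h s) (Real.exp_nonneg _)
      _ = _ := by rw [← Real.exp_add]; push_cast; ring_nf

/-- If each round decreases a nonnegative potential by `r` in expectation, then the expected sum
of `r` along the transcript is at most the initial potential. -/
lemma sum_transcriptProb_mul_sum_le {K : S → Ω → ℝ} (hK : ∀ s a, 0 < K s a)
    (hK1 : ∀ s, ∑ a, K s a = 1) {Φ r : S → ℝ} (hΦ : ∀ s, 0 ≤ Φ s)
    (h : ∀ s, ∑ x, K s x * Φ (upd s x) ≤ Φ s - r s) :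
    ∀ (T : ℕ) (s : S), ∑ ω, transcriptProb upd K T s ω *
      ∑ t, r (transcriptState upd T s ω t) ≤ Φ s
  | 0, s => by simpa [transcriptProb] using hΦ s
  | T + 1, s => by
    simp only [transcriptProb, transcriptState, Fin.sum_univ_succ, Fin.cons_zero, Fin.cons_succ]
    rw [sum_fin_succ_pi fun x ω => K s x * transcriptProb upd K T (upd s x) ω *
      (r s + ∑ t, r (transcriptState upd T (upd s x) ω t))]
    calc _ = ∑ x, K s x * (r s + ∑ ω, transcriptProb upd K T (upd s x) ω *
          ∑ t, r (transcriptState upd T (upd s x) ω t)) := by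
          refine Finset.sum_congr rfl fun x _ => ?_
          simp only [mul_add, mul_assoc, Finset.sum_add_distrib, ← Finset.mul_sum]
          rw [← Finset.sum_mul, sum_transcriptProb hK1, one_mul]
      _ ≤ ∑ x, K s x * (r s + Φ (upd s x)) := by
          refine Finset.sum_le_sum fun x _ => mul_le_mul_of_nonneg_left ?_ (hK _ _).le
          linarith [sum_transcriptProb_mul_sum_le hK hK1 hΦ h T (upd s x)]
      _ = r s + ∑ x, K s x * Φ (upd s x) := by
          simp only [mul_add, Finset.sum_add_distrib, ← Finset.sum_mul, hK1, one_mul]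
      _ ≤ Φ s := by linarith [h s]

end Adaptive

/-! ### The exponential mechanism -/

section softmax

variable {ι : Type*} [Fintype ι]

/-- The probability vector proportional to `exp (u i)`. -/
def softmax (u : ι → ℝ) (i : ι) : ℝ := Real.exp (u i) / ∑ j, Real.exp (u j)

variable [Nonempty ι]

lemma sum_exp_pos (u : ι → ℝ) : 0 < ∑ j, Real.exp (u j) :=
  Finset.sum_pos (fun _ _ => Real.exp_pos _) Finset.univ_nonempty

lemma softmax_pos (u : ι → ℝ) (i : ι) : 0 < softmax u i :=
  div_pos (Real.exp_pos _) (sum_exp_pos u)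

lemma sum_softmax (u : ι → ℝ) : ∑ i, softmax u i = 1 := by
  simp only [softmax]
  rw [← Finset.sum_div, div_self (sum_exp_pos u).ne']

lemma log_softmax (u : ι → ℝ) (i : ι) :
    Real.log (softmax u i) = u i - Real.log (∑ j, Real.exp (u j)) := by
  rw [softmax, Real.log_div (Real.exp_ne_zero _) (sum_exp_pos u).ne', Real.log_exp]

/-- Utility of the exponential mechanism. -/
lemma sub_log_card_le_sum_softmax (u : ι → ℝ) (i₀ : ι) :
    u i₀ - Real.log (Fintype.card ι) ≤ ∑ i, softmax u i * u i := by
  have hN : (0 : ℝ) < Fintype.card ι := by exact_mod_cast Fintype.card_pos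
  have h1 : u i₀ ≤ Real.log (∑ j, Real.exp (u j)) := by
    rw [Real.le_log_iff_exp_le (sum_exp_pos u)]
    exact Finset.single_le_sum (f := fun j => Real.exp (u j)) (fun _ _ => Real.exp_nonneg _)
      (Finset.mem_univ i₀)
  -- Jensen applied to `1 / softmax`: the entropy is at most the logarithm of the cardinality.
  have h2 := sum_mul_log_le (x := fun i => (softmax u i)⁻¹) (B := Real.log (Fintype.card ι))
    (fun i => (softmax_pos u i).le) (sum_softmax u) (fun i => inv_pos.2 (softmax_pos u i)) (by
      rw [Real.exp_log hN]
      simp [mul_inv_cancel₀ (softmax_pos u _).ne'])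
  simp only [Real.log_inv, log_softmax, neg_sub, mul_sub, Finset.sum_sub_distrib,
    ← Finset.sum_mul, sum_softmax, one_mul] at h2
  linarith

/-- Privacy of the exponential mechanism. -/
lemma sum_softmax_div_rpow_le {u u' : ι → ℝ} {c a : ℝ} (h : ∀ i, |u i - u' i| ≤ c)
    (ha : 0 ≤ a) :
    ∑ i, softmax u i * (softmax u i / softmax u' i) ^ a
      ≤ Real.exp ((a ^ 2 + a) * (c ^ 2 / 2)) := by
  refine sum_mul_div_rpow_le (softmax_pos u) (softmax_pos u') (sum_softmax u) (sum_softmax u')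
    -- The normalizing constants only shift the log-ratio; its range still has width `2 * c`.
    (lo := -c - Real.log (∑ j, Real.exp (u j)) + Real.log (∑ j, Real.exp (u' j)))
    (fun i => ?_) (fun i => ?_) ha
  all_goals
    rw [Real.log_div (softmax_pos u i).ne' (softmax_pos u' i).ne', log_softmax, log_softmax]
    have := abs_le.1 (h i)
    linarith

end softmax

/-! ### Randomized signs -/

section signs

variable {κ : Type*} [Fintype κ]

/-- The sign `±1` encoded by a Boolean. -/
def boolSign (b : Bool) : ℝ := if b then 1 else -1

/-- The vector of signs encoded by a vector of Booleans. -/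
def signVec (v : κ → Bool) : EuclideanSpace ℝ κ := WithLp.toLp 2 fun c => boolSign (v c)

/-- The distribution of a vector of independent signs with mean `x`. -/
def signProb (x : EuclideanSpace ℝ κ) (v : κ → Bool) : ℝ := ∏ c, (1 + boolSign (v c) * x c) / 2

lemma signFactor_pos {x : ℝ} (hx : |x| ≤ 1 / 2) (b : Bool) : 0 < (1 + boolSign b * x) / 2 := by
  have := abs_le.1 hx
  cases b <;> simp [boolSign] <;> linarith

lemma signProb_pos {x : EuclideanSpace ℝ κ} (hx : ∀ c, |x c| ≤ 1 / 2) (v : κ → Bool) :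
    0 < signProb x v :=
  Finset.prod_pos fun c _ => signFactor_pos (hx c) _

lemma sum_signFactor (x : ℝ) : ∑ b, (1 + boolSign b * x) / 2 = 1 := by
  simp [boolSign]; ring

variable [DecidableEq κ]

lemma sum_signProb (x : EuclideanSpace ℝ κ) : ∑ v, signProb x v = 1 := by
  simp only [signProb]
  rw [← Fintype.prod_sum fun c b => (1 + boolSign b * x c) / 2]
  simp only [sum_signFactor, Finset.prod_const_one]

/-- Independence factors the exponential moment, and Hoeffding bounds each sign. Only `‖t‖` enters,
which makes the utility analysis independent of the dimension. -/
lemma sum_signProb_mul_exp_le {x : EuclideanSpace ℝ κ} (hx : ∀ c, |x c| ≤ 1 / 2)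
    (t : EuclideanSpace ℝ κ) :
    ∑ v, signProb x v * Real.exp (inner ℝ t (signVec v))
      ≤ Real.exp (inner ℝ t x + ‖t‖ ^ 2 / 2) := by
  have e : ∀ v : κ → Bool, signProb x v * Real.exp (inner ℝ t (signVec v))
      = ∏ c, (1 + boolSign (v c) * x c) / 2 * Real.exp (t c * boolSign (v c)) := by
    intro v
    rw [Finset.prod_mul_distrib, ← Real.exp_sum, signProb]
    simp [PiLp.inner_apply, signVec, mul_comm]
  simp only [e]
  rw [← Fintype.prod_sum fun c b => (1 + boolSign b * x c) / 2 * Real.exp (t c * boolSign b)]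
  have e2 : inner ℝ t x + ‖t‖ ^ 2 / 2 = ∑ c, (t c * x c + t c ^ 2 * 1 ^ 2 / 2) := by
    rw [EuclideanSpace.real_norm_sq_eq, Finset.sum_add_distrib, Finset.sum_div]
    simp [PiLp.inner_apply, mul_comm]
  rw [e2, Real.exp_sum]
  refine Finset.prod_le_prod (fun c _ => Finset.sum_nonneg fun b _ =>
    mul_nonneg (signFactor_pos (hx c) b).le (Real.exp_nonneg _)) fun c _ => ?_
  have h := sum_mul_exp_le (x := boolSign) (lo := -1) (c := 1)
    (fun b => (signFactor_pos (hx c) b).le) (sum_signFactor (x c))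
    (fun b => by cases b <;> norm_num [boolSign]) (fun b => by cases b <;> norm_num [boolSign])
    (t c)
  refine h.trans (Real.exp_le_exp.2 (le_of_eq ?_))
  simp only [boolSign, Fintype.sum_bool]
  simp only [if_true, Bool.false_eq_true, if_false]
  ring

lemma abs_log_signFactor_div_le {x y : ℝ} (hx : |x| ≤ 1 / 2) (hy : |y| ≤ 1 / 2) (b : Bool) :
    |Real.log ((1 + boolSign b * x) / 2 / ((1 + boolSign b * y) / 2))| ≤ 2 * |x - y| := by
  have key : ∀ {x y : ℝ}, |x| ≤ 1 / 2 → |y| ≤ 1 / 2 →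
      Real.log ((1 + boolSign b * x) / 2 / ((1 + boolSign b * y) / 2)) ≤ 2 * |x - y| := by
    intro x y hx hy
    have hx' := signFactor_pos hx b
    have hy' := signFactor_pos hy b
    refine (Real.log_le_sub_one_of_pos (div_pos hx' hy')).trans ?_
    -- The reason for biases at most `1 / 2`: the denominator stays away from zero, so `log (p / q)
    -- ≤ (p - q) / q` gives the factor `2`.
    have h4 : (1 : ℝ) / 4 ≤ (1 + boolSign b * y) / 2 := by
      have := abs_le.1 hy
      cases b <;> simp [boolSign] <;> linarith
    rw [div_sub_one hy'.ne', div_le_iff₀ hy']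
    have h5 : (1 + boolSign b * x) / 2 - (1 + boolSign b * y) / 2 ≤ |x - y| / 2 := by
      have := neg_abs_le (x - y)
      have := le_abs_self (x - y)
      cases b <;> simp [boolSign] <;> linarith
    nlinarith [abs_nonneg (x - y)]
  refine abs_le.2 ⟨?_, key hx hy⟩
  have := key hy hx
  rw [← inv_div, Real.log_inv, abs_sub_comm] at this
  linarith

/-- The moments factor over coordinates, so the squared coordinate differences add up to `‖x - y‖ ^
2`: signs cost as much privacy as Gaussian noise, up to constants. -/
lemma sum_signProb_div_rpow_le {x y : EuclideanSpace ℝ κ} (hx : ∀ c, |x c| ≤ 1 / 2)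
    (hy : ∀ c, |y c| ≤ 1 / 2) {a : ℝ} (ha : 0 ≤ a) :
    ∑ v, signProb x v * (signProb x v / signProb y v) ^ a
      ≤ Real.exp ((a ^ 2 + a) * (2 * ‖x - y‖ ^ 2)) := by
  have e : ∀ v : κ → Bool, signProb x v * (signProb x v / signProb y v) ^ a
      = ∏ c, (1 + boolSign (v c) * x c) / 2 *
        ((1 + boolSign (v c) * x c) / 2 / ((1 + boolSign (v c) * y c) / 2)) ^ a := by
    intro v
    rw [Finset.prod_mul_distrib, Real.finsetProd_rpow _ _ fun c _ =>
      (div_pos (signFactor_pos (hx c) _) (signFactor_pos (hy c) _)).le, signProb, signProb,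
      ← Finset.prod_div_distrib]
  simp only [e]
  rw [← Fintype.prod_sum fun c b => (1 + boolSign b * x c) / 2 *
        ((1 + boolSign b * x c) / 2 / ((1 + boolSign b * y c) / 2)) ^ a]
  rw [EuclideanSpace.real_norm_sq_eq, Finset.mul_sum, Finset.mul_sum, Real.exp_sum]
  refine Finset.prod_le_prod (fun c _ => Finset.sum_nonneg fun b _ =>
    mul_nonneg (signFactor_pos (hx c) b).le (Real.rpow_nonneg
      (div_pos (signFactor_pos (hx c) b) (signFactor_pos (hy c) b)).le _)) fun c _ => ?_
  have hb := fun b => abs_le.1 (abs_log_signFactor_div_le (hx c) (hy c) b)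
  have h := sum_mul_div_rpow_le (lo := -(2 * |x c - y c|)) (c := 2 * |x c - y c|)
    (signFactor_pos (hx c)) (signFactor_pos (hy c)) (sum_signFactor _) (sum_signFactor _)
    (fun b => (hb b).1) (fun b => by linarith [(hb b).2]) ha
  refine h.trans (Real.exp_le_exp.2 (le_of_eq ?_))
  rw [mul_pow, sq_abs, PiLp.sub_apply]
  ring

end signs

/-! ### One round: selection, noisy signs, weight update -/

section Round

set_option linter.unusedSectionVars false

variable {Y ι : Type*} [Fintype Y] [Nonempty Y] [Fintype ι] [Nonempty ι] {n : ℕ}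
  {κ : ι → Type*} [∀ i, Fintype (κ i)] [∀ i, DecidableEq (κ i)]

/-- Jensen moves the average over signs inside the logarithm. Sub-Gaussian signs then cost `2 * η ^
2 * G ^ 2` because `‖f z - f y‖ ≤ 2 * G`, and Hoeffding over `z` drawn from `h` costs the last term.
-/
lemma sum_signProb_mul_log_le {E : Type*} [Fintype E] [DecidableEq E] {x : EuclideanSpace ℝ E}
    (hx : ∀ c, |x c| ≤ 1 / 2) {h : Y → ℝ} (hh : ∀ z, 0 < h z) (hh1 : ∑ z, h z = 1)
    {f : Y → EuclideanSpace ℝ E} {G : ℝ} (hf : ∀ z, ‖f z‖ ≤ G) (y : Y) (η : ℝ) :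
    ∑ v, signProb x v * Real.log (∑ z, h z * Real.exp (η * inner ℝ (f z - f y) (signVec v)))
      ≤ η * inner ℝ (∑ z, h z • f z - f y) x + 2 * η ^ 2 * G ^ 2 + (η * (G * ‖x‖)) ^ 2 / 2 := by
  refine sum_mul_log_le (fun v => (signProb_pos hx v).le) (sum_signProb x)
    (fun v => Finset.sum_pos (fun z _ => mul_pos (hh z) (Real.exp_pos _))
      Finset.univ_nonempty) ?_
  have hG : 0 ≤ G := (norm_nonneg _).trans (hf y)
  have hin : ∀ z, |inner ℝ (f z) x| ≤ G * ‖x‖ := fun z =>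
    (abs_real_inner_le_norm _ _).trans (mul_le_mul_of_nonneg_right (hf z) (norm_nonneg _))
  have hz : ∀ z, ∑ v, signProb x v * Real.exp (η * inner ℝ (f z - f y) (signVec v))
      ≤ Real.exp (2 * η ^ 2 * G ^ 2) * Real.exp (η * inner ℝ (f z - f y) x) := by
    intro z
    have h1 := sum_signProb_mul_exp_le hx (η • (f z - f y))
    simp only [real_inner_smul_left] at h1
    refine h1.trans ?_
    rw [← Real.exp_add, Real.exp_le_exp, norm_smul, mul_pow, Real.norm_eq_abs, sq_abs]
    have h2 : ‖f z - f y‖ ≤ 2 * G := (norm_sub_le _ _).trans (by linarith [hf z, hf y])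
    have h3 : ‖f z - f y‖ ^ 2 ≤ (2 * G) ^ 2 := pow_le_pow_left₀ (norm_nonneg _) h2 2
    nlinarith [mul_le_mul_of_nonneg_left h3 (sq_nonneg η)]
  have hH := sum_mul_exp_le (x := fun z => inner ℝ (f z - f y) x)
    (lo := -(inner ℝ (f y) x) - G * ‖x‖) (c := G * ‖x‖) (fun z => (hh z).le) hh1
    (fun z => by simp only [inner_sub_left]; linarith [(abs_le.1 (hin z)).1])
    (fun z => by simp only [inner_sub_left]; linarith [(abs_le.1 (hin z)).2]) η
  have hmean : ∑ z, h z * inner ℝ (f z - f y) x = inner ℝ (∑ z, h z • f z - f y) x := by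
    simp only [inner_sub_left, mul_sub, Finset.sum_sub_distrib, ← Finset.sum_mul, hh1, one_mul,
      sum_inner, real_inner_smul_left]
  calc ∑ v, signProb x v * ∑ z, h z * Real.exp (η * inner ℝ (f z - f y) (signVec v))
      = ∑ z, h z * ∑ v, signProb x v * Real.exp (η * inner ℝ (f z - f y) (signVec v)) := by
        simp only [Finset.mul_sum]
        rw [Finset.sum_comm]
        exact Finset.sum_congr rfl fun _ _ => Finset.sum_congr rfl fun _ _ => by ring
    _ ≤ ∑ z, h z * (Real.exp (2 * η ^ 2 * G ^ 2) * Real.exp (η * inner ℝ (f z - f y) x)) :=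
        Finset.sum_le_sum fun z _ => mul_le_mul_of_nonneg_left (hz z) (hh z).le
    _ = Real.exp (2 * η ^ 2 * G ^ 2) * ∑ z, h z * Real.exp (η * inner ℝ (f z - f y) x) := by
        rw [Finset.mul_sum]
        exact Finset.sum_congr rfl fun _ _ => by ring
    _ ≤ Real.exp (2 * η ^ 2 * G ^ 2) * _ := mul_le_mul_of_nonneg_left hH (Real.exp_nonneg _)
    _ = _ := by
        rw [← Real.exp_add, hmean]
        ring_nf

variable (F : (Fin n → Y → ℝ) → ∀ i, Fin n → Y → EuclideanSpace ℝ (κ i))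

/-- The difference between the true answer to the vector query `F θ i` and its answer on the
synthetic data with log-weights `θ`. -/
def queryGap (y : Fin n → Y) (θ : Fin n → Y → ℝ) (i : ι) : EuclideanSpace ℝ (κ i) :=
  (1 / (n : ℝ)) • ∑ j, (F θ i j (y j) - ∑ z, softmax (θ j) z • F θ i j z)

/-- One round: select a query by the exponential mechanism, then release noisy signs of its gap. -/
def roundProb (b s : ℝ) (y : Fin n → Y) (θ : Fin n → Y → ℝ) (ω : Σ i, (κ i → Bool)) : ℝ :=
  softmax (fun i => b * ‖queryGap F y θ i‖) ω.1 * signProb (s • queryGap F y θ ω.1) ω.2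

/-- The multiplicative weights update. -/
def updateWeights (η : ℝ) (θ : Fin n → Y → ℝ) (ω : Σ i, (κ i → Bool)) : Fin n → Y → ℝ :=
  fun j z => θ j z + η * inner ℝ (F θ ω.1 j z) (signVec ω.2)

/-- The average cross-entropy of the synthetic data relative to the true data. -/
def crossEntropy (y : Fin n → Y) (θ : Fin n → Y → ℝ) : ℝ :=
  (1 / (n : ℝ)) * ∑ j, (Real.log (∑ z, Real.exp (θ j z)) - θ j (y j))

omit [Nonempty Y] in
lemma crossEntropy_nonneg (y : Fin n → Y) (θ : Fin n → Y → ℝ) : 0 ≤ crossEntropy y θ := by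
  refine mul_nonneg (by positivity) (Finset.sum_nonneg fun j _ => sub_nonneg.2 ?_)
  have : Nonempty Y := ⟨y j⟩
  rw [Real.le_log_iff_exp_le (sum_exp_pos _)]
  exact Finset.single_le_sum (f := fun z => Real.exp (θ j z)) (fun _ _ => Real.exp_nonneg _)
    (Finset.mem_univ (y j))

omit [Nonempty Y] in
lemma crossEntropy_zero (hn : 0 < n) (y : Fin n → Y) :
    crossEntropy y (fun _ _ => 0) = Real.log (Fintype.card Y) := by
  simp [crossEntropy, hn.ne']

variable {F} {G s b : ℝ}

/-- The synthetic answers are the same for both inputs and cancel; one true answer remains. This is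
the sensitivity in both halves of a round. -/
lemma norm_queryGap_sub_le (hG : ∀ θ i j z, ‖F θ i j z‖ ≤ G) {y y' : Fin n → Y} {j₀ : Fin n}
    (hy : ∀ j, j ≠ j₀ → y j = y' j) (θ : Fin n → Y → ℝ) (i : ι) :
    ‖queryGap F y θ i - queryGap F y' θ i‖ ≤ 2 * G / n := by
  rw [queryGap, queryGap, ← smul_sub, ← Finset.sum_sub_distrib, Finset.sum_eq_single j₀]
  · rw [norm_smul, sub_sub_sub_cancel_right, Real.norm_eq_abs, abs_of_nonneg (by positivity),
      one_div_mul_eq_div]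
    gcongr
    exact (norm_sub_le _ _).trans (by linarith [hG θ i j₀ (y j₀), hG θ i j₀ (y' j₀)])
  · exact fun j _ hj => by rw [hy j hj, sub_self]
  · simp

lemma abs_queryGap_le (hn : 0 < n) {B : ℝ} (hB : ∀ θ i j z c, |F θ i j z c| ≤ B)
    (y : Fin n → Y) (θ : Fin n → Y → ℝ) (i : ι) (c : κ i) : |queryGap F y θ i c| ≤ 2 * B := by
  have h1 : ∀ j, |F θ i j (y j) c - ∑ z, softmax (θ j) z * F θ i j z c| ≤ 2 * B := by
    intro j
    have h2 : |∑ z, softmax (θ j) z * F θ i j z c| ≤ B := by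
      calc _ ≤ ∑ z, |softmax (θ j) z * F θ i j z c| := Finset.abs_sum_le_sum_abs _ _
        _ ≤ ∑ z, softmax (θ j) z * B := Finset.sum_le_sum fun z _ => by
            rw [abs_mul, abs_of_pos (softmax_pos _ _)]
            exact mul_le_mul_of_nonneg_left (hB _ _ _ _ _) (softmax_pos _ _).le
        _ = B := by rw [← Finset.sum_mul, sum_softmax, one_mul]
    exact (abs_sub _ _).trans (by linarith [hB θ i j (y j) c])
  have hn' : (0 : ℝ) < n := by exact_mod_cast hn
  have e : queryGap F y θ i c
      = (1 / (n : ℝ)) * ∑ j, (F θ i j (y j) c - ∑ z, softmax (θ j) z * F θ i j z c) := by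
    simp [queryGap]
  rw [e, abs_mul, abs_of_pos (by positivity), one_div_mul_eq_div, div_le_iff₀ hn']
  calc _ ≤ ∑ j, |F θ i j (y j) c - ∑ z, softmax (θ j) z * F θ i j z c| :=
        Finset.abs_sum_le_sum_abs _ _
    _ ≤ ∑ _j : Fin n, 2 * B := Finset.sum_le_sum fun j _ => h1 j
    _ = _ := by simp; ring

lemma roundProb_pos (hs : ∀ y θ i c, |(s • queryGap F y θ i) c| ≤ 1 / 2) (y : Fin n → Y)
    (θ : Fin n → Y → ℝ) (ω : Σ i, (κ i → Bool)) : 0 < roundProb F b s y θ ω :=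
  mul_pos (softmax_pos _ _) (signProb_pos (hs y θ ω.1) _)

lemma sum_roundProb (y : Fin n → Y) (θ : Fin n → Y → ℝ) :
    ∑ ω, roundProb F b s y θ ω = 1 := by
  rw [Fintype.sum_sigma]
  refine Eq.trans (Finset.sum_congr rfl fun i _ => ?_) (sum_softmax fun i => b * ‖queryGap F y θ i‖)
  simp only [roundProb]
  rw [← Finset.mul_sum]
  exact (congrArg _ (sum_signProb (s • queryGap F y θ i))).trans (mul_one _)

/-- Privacy of one round. -/
lemma sum_roundProb_div_rpow_le (hs : ∀ y θ i c, |(s • queryGap F y θ i) c| ≤ 1 / 2)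
    (hG : ∀ θ i j z, ‖F θ i j z‖ ≤ G) (hb : 0 ≤ b) {y y' : Fin n → Y} {j₀ : Fin n}
    (hy : ∀ j, j ≠ j₀ → y j = y' j) (θ : Fin n → Y → ℝ) {a : ℝ} (ha : 0 ≤ a) :
    ∑ ω, roundProb F b s y θ ω * (roundProb F b s y θ ω / roundProb F b s y' θ ω) ^ a
      ≤ Real.exp ((a ^ 2 + a) * ((b ^ 2 / 2 + 2 * s ^ 2) * (2 * G / n) ^ 2)) := by
  have hgap := norm_queryGap_sub_le hG hy θ
  rw [Fintype.sum_sigma]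
  have hsm := sum_softmax_div_rpow_le (u := fun i => b * ‖queryGap F y θ i‖)
    (u' := fun i => b * ‖queryGap F y' θ i‖) (c := b * (2 * G / n)) (fun i => by
      rw [← mul_sub, abs_mul, abs_of_nonneg hb]
      exact mul_le_mul_of_nonneg_left ((abs_norm_sub_norm_le _ _).trans (hgap i)) hb) ha
  set u := softmax fun i => b * ‖queryGap F y θ i‖ with hu
  set u' := softmax fun i => b * ‖queryGap F y' θ i‖ with hu'
  have hupos : ∀ i, 0 < u i := softmax_pos _
  have hupos' : ∀ i, 0 < u' i := softmax_pos _
  have ha2 : 0 ≤ a ^ 2 + a := by positivity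
  calc _ = ∑ i, u i * (u i / u' i) ^ a * ∑ v, signProb (s • queryGap F y θ i) v *
        (signProb (s • queryGap F y θ i) v / signProb (s • queryGap F y' θ i) v) ^ a := by
        refine Finset.sum_congr rfl fun i _ => ?_
        rw [Finset.mul_sum]
        refine Finset.sum_congr rfl fun v _ => ?_
        simp only [roundProb, ← hu, ← hu']
        rw [mul_div_mul_comm, Real.mul_rpow (div_pos (hupos i) (hupos' i)).le
          (div_pos (signProb_pos (hs y θ i) v) (signProb_pos (hs y' θ i) v)).le]
        ring
    _ ≤ ∑ i, u i * (u i / u' i) ^ a *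
          Real.exp ((a ^ 2 + a) * (2 * s ^ 2 * (2 * G / n) ^ 2)) := by
        refine Finset.sum_le_sum fun i _ => mul_le_mul_of_nonneg_left ?_
          (mul_nonneg (hupos i).le (Real.rpow_nonneg (div_pos (hupos i) (hupos' i)).le _))
        refine (sum_signProb_div_rpow_le (hs y θ i) (hs y' θ i) ha).trans
          (Real.exp_le_exp.2 (mul_le_mul_of_nonneg_left ?_ ha2))
        rw [← smul_sub, norm_smul, mul_pow, Real.norm_eq_abs, sq_abs, mul_assoc]
        have := pow_le_pow_left₀ (norm_nonneg _) (hgap i) 2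
        gcongr
    _ ≤ Real.exp ((a ^ 2 + a) * ((b * (2 * G / n)) ^ 2 / 2)) *
          Real.exp ((a ^ 2 + a) * (2 * s ^ 2 * (2 * G / n) ^ 2)) := by
        rw [← Finset.sum_mul]
        exact mul_le_mul_of_nonneg_right hsm (Real.exp_nonneg _)
    _ = _ := by rw [← Real.exp_add]; ring_nf

/-- Expected decrease of the cross-entropy after updating with noisy signs of the `i`-th gap. -/
lemma sum_signProb_mul_crossEntropy_le (hs : ∀ y θ i c, |(s • queryGap F y θ i) c| ≤ 1 / 2)
    (hG : ∀ θ i j z, ‖F θ i j z‖ ≤ G) (hG0 : 0 < G) (hs0 : 0 < s) (hn : 0 < n)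
    (y : Fin n → Y) (θ : Fin n → Y → ℝ) (i : ι) :
    ∑ v, signProb (s • queryGap F y θ i) v *
        crossEntropy y (updateWeights F (1 / (G ^ 2 * s)) θ ⟨i, v⟩)
      ≤ crossEntropy y θ - (‖queryGap F y θ i‖ ^ 2 - 4 / s ^ 2) / (2 * G ^ 2) := by
  set η : ℝ := 1 / (G ^ 2 * s) with hη
  set x := s • queryGap F y θ i with hx
  have hn' : (0 : ℝ) < n := by exact_mod_cast hn
  -- The increment of the cross-entropy is a log-moment under the current softmax.
  have hstep : ∀ v j, Real.log (∑ z, Real.exp (updateWeights F η θ ⟨i, v⟩ j z))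
      - updateWeights F η θ ⟨i, v⟩ j (y j)
      = (Real.log (∑ z, Real.exp (θ j z)) - θ j (y j)) + Real.log (∑ z, softmax (θ j) z *
        Real.exp (η * inner ℝ (F θ i j z - F θ i j (y j)) (signVec v))) := by
    intro v j
    have e : ∑ z, Real.exp (updateWeights F η θ ⟨i, v⟩ j z)
        = (∑ z, Real.exp (θ j z)) * Real.exp (η * inner ℝ (F θ i j (y j)) (signVec v)) *
          ∑ z, softmax (θ j) z *
            Real.exp (η * inner ℝ (F θ i j z - F θ i j (y j)) (signVec v)) := by
      rw [Finset.mul_sum]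
      refine Finset.sum_congr rfl fun z _ => ?_
      rw [updateWeights, softmax, inner_sub_left, mul_sub, Real.exp_sub, Real.exp_add]
      field_simp [(sum_exp_pos (θ j)).ne']
    have hpos : 0 < ∑ z, softmax (θ j) z *
        Real.exp (η * inner ℝ (F θ i j z - F θ i j (y j)) (signVec v)) :=
      Finset.sum_pos (fun z _ => mul_pos (softmax_pos _ _) (Real.exp_pos _))
        Finset.univ_nonempty
    rw [e, Real.log_mul (mul_pos (sum_exp_pos _) (Real.exp_pos _)).ne' hpos.ne',
      Real.log_mul (sum_exp_pos _).ne' (Real.exp_ne_zero _), Real.log_exp, updateWeights]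
    ring
  have hlog := fun j => sum_signProb_mul_log_le (hs y θ i) (softmax_pos (θ j))
    (sum_softmax (θ j)) (hG θ i j) (y j) η
  rw [← hx] at hlog
  have hsumgap : ∑ j, inner ℝ (∑ z, softmax (θ j) z • F θ i j z - F θ i j (y j)) x
      = -(n * (s * ‖queryGap F y θ i‖ ^ 2)) := by
    rw [← sum_inner]
    have : ∑ j, (∑ z, softmax (θ j) z • F θ i j z - F θ i j (y j))
        = -((n : ℝ) • queryGap F y θ i) := by
      rw [queryGap, smul_smul, mul_one_div_cancel hn'.ne', one_smul, ← Finset.sum_neg_distrib]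
      simp
    rw [this, hx, inner_neg_left, real_inner_smul_left, real_inner_smul_right,
      real_inner_self_eq_norm_sq]
  calc _ = (1 / (n : ℝ)) * ∑ j, ((Real.log (∑ z, Real.exp (θ j z)) - θ j (y j)) +
        ∑ v, signProb x v * Real.log (∑ z, softmax (θ j) z *
          Real.exp (η * inner ℝ (F θ i j z - F θ i j (y j)) (signVec v)))) := by
        simp only [crossEntropy, hstep]
        simp only [mul_left_comm _ (1 / (n : ℝ)), ← Finset.mul_sum]
        congr 1
        simp only [Finset.mul_sum]
        rw [Finset.sum_comm]
        refine Finset.sum_congr rfl fun j _ => ?_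
        simp only [mul_add, Finset.sum_add_distrib, ← Finset.sum_mul, x, sum_signProb, one_mul]
    _ ≤ (1 / (n : ℝ)) * ∑ j, ((Real.log (∑ z, Real.exp (θ j z)) - θ j (y j)) +
        (η * inner ℝ (∑ z, softmax (θ j) z • F θ i j z - F θ i j (y j)) x + 2 * η ^ 2 * G ^ 2
          + (η * (G * ‖x‖)) ^ 2 / 2)) := by
        refine mul_le_mul_of_nonneg_left (Finset.sum_le_sum fun j _ => ?_) (by positivity)
        exact add_le_add_right (hlog j) _
    _ = crossEntropy y θ - η * (s * ‖queryGap F y θ i‖ ^ 2) + 2 * η ^ 2 * G ^ 2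
          + (η * (G * ‖x‖)) ^ 2 / 2 := by
        rw [Finset.sum_add_distrib, Finset.sum_add_distrib, Finset.sum_add_distrib,
          ← Finset.mul_sum, hsumgap, crossEntropy]
        simp only [Finset.sum_const, Finset.card_univ, Fintype.card_fin, nsmul_eq_mul]
        field_simp
        ring
    -- The step size `1 / (G ^ 2 * s)` makes the quadratic term in the gap exactly half of the
    -- linear gain.
    _ = _ := by
        rw [hx, norm_smul, Real.norm_eq_abs, abs_of_pos hs0, hη]
        field_simp
        ring

/-- Expected decrease of the cross-entropy in one round. -/
lemma sum_roundProb_mul_crossEntropy_le (hs : ∀ y θ i c, |(s • queryGap F y θ i) c| ≤ 1 / 2)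
    (hG : ∀ θ i j z, ‖F θ i j z‖ ≤ G) (hG0 : 0 < G) (hs0 : 0 < s) (hb : 0 < b) (hn : 0 < n)
    (y : Fin n → Y) (i₀ : ι) (θ : Fin n → Y → ℝ) :
    ∑ ω, roundProb F b s y θ ω * crossEntropy y (updateWeights F (1 / (G ^ 2 * s)) θ ω)
      ≤ crossEntropy y θ - (‖queryGap F y θ i₀‖ ^ 2 / 2 - (Real.log (Fintype.card ι) / b) ^ 2
          - 4 / s ^ 2) / (2 * G ^ 2) := by
  rw [Fintype.sum_sigma]
  set r : ι → ℝ := fun i => ‖queryGap F y θ i‖ with hr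
  set P := softmax fun i => b * r i with hP
  have hP0 : ∀ i, 0 < P i := softmax_pos _
  have hP1 : ∑ i, P i = 1 := sum_softmax _
  have h1 : r i₀ - Real.log (Fintype.card ι) / b ≤ ∑ i, P i * r i := by
    have := sub_log_card_le_sum_softmax (fun i => b * r i) i₀
    simp only [mul_left_comm _ b, ← Finset.mul_sum] at this
    rw [sub_le_iff_le_add, ← mul_le_mul_iff_right₀ hb, mul_add, mul_div_cancel₀ _ hb.ne']
    linarith
  have h2 : (∑ i, P i * r i) ^ 2 ≤ ∑ i, P i * r i ^ 2 :=
    Real.pow_arith_mean_le_arith_mean_pow_of_even _ P r (fun i _ => (hP0 i).le) hP1 even_two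
  -- If `r i₀ ≤ β` the left side is not positive; otherwise `(r i₀ - β) ^ 2 ≥ r i₀ ^ 2 / 2 - β ^ 2`.
  have h3 : r i₀ ^ 2 / 2 - (Real.log (Fintype.card ι) / b) ^ 2 ≤ ∑ i, P i * r i ^ 2 := by
    set β := Real.log (Fintype.card ι) / b
    have hr0 : 0 ≤ r i₀ := norm_nonneg _
    have hβ : 0 ≤ β := div_nonneg (Real.log_nonneg (by exact_mod_cast Fintype.card_pos)) hb.le
    by_cases hc : r i₀ ≤ β
    · have : 0 ≤ ∑ i, P i * r i ^ 2 := (sq_nonneg _).trans h2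
      nlinarith
    · have : (r i₀ - β) ^ 2 ≤ (∑ i, P i * r i) ^ 2 :=
        pow_le_pow_left₀ (by linarith) h1 2
      nlinarith [sq_nonneg (r i₀ - 2 * β)]
  calc _ = ∑ i, P i * ∑ v, signProb (s • queryGap F y θ i) v *
        crossEntropy y (updateWeights F (1 / (G ^ 2 * s)) θ ⟨i, v⟩) := by
        simp only [roundProb, mul_assoc, ← Finset.mul_sum, hP, hr]
    _ ≤ ∑ i, P i * (crossEntropy y θ - (r i ^ 2 - 4 / s ^ 2) / (2 * G ^ 2)) :=
        Finset.sum_le_sum fun i _ => mul_le_mul_of_nonneg_left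
          (sum_signProb_mul_crossEntropy_le hs hG hG0 hs0 hn y θ i) (hP0 i).le
    _ = crossEntropy y θ - (∑ i, P i * r i ^ 2 - 4 / s ^ 2) / (2 * G ^ 2) := by
        simp only [mul_sub, mul_div_assoc', sub_div, Finset.sum_sub_distrib, ← Finset.sum_mul,
          ← Finset.sum_div, hP1, one_mul]
    _ ≤ _ := by gcongr

end Round

/-! ### The mechanism of `T` rounds -/

/-- Private multiplicative weights for adaptively chosen families of vector queries. -/
theorem exists_private_multiplicative_weights {Y : Type*} {ι : Type} [Fintype Y] [Nonempty Y] [Fintype ι]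
    [Nonempty ι] {n T : ℕ} {κ : ι → Type} [∀ i, Fintype (κ i)] [∀ i, DecidableEq (κ i)]
    (F : (Fin n → Y → ℝ) → ∀ i, Fin n → Y → EuclideanSpace ℝ (κ i)) {G α Λ ε δ a : ℝ}
    (hn : 0 < n) (hG0 : 0 < G) (hα : 0 < α) (hΛ : 0 < Λ) (ha : 0 ≤ a) (hδ : 0 < δ)
    (hG : ∀ θ i j z, ‖F θ i j z‖ ≤ G) (hF : ∀ θ i j z c, |F θ i j z c| ≤ α / 4)
    (hι : Real.log (Fintype.card ι) ≤ Λ)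
    (hT : G ^ 2 * Real.log (Fintype.card Y) ≤ T * α ^ 2)
    (hpriv : T * ((a ^ 2 + a) * (((Λ / α) ^ 2 / 2 + 2 * (1 / α) ^ 2) * (2 * G / n) ^ 2))
      ≤ Real.log δ + a * ε) :
    ∃ (Ω : Type) (_ : Fintype Ω) (p : (Fin n → Y) → Ω → ℝ)
      (st : Ω → Fin T → (Fin n → Y → ℝ)),
      (∀ y ω, 0 < p y ω) ∧ (∀ y, ∑ ω, p y ω = 1) ∧
      (∀ y y' : Fin n → Y, (∃ j₀, ∀ j, j ≠ j₀ → y j = y' j) →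
        ∑ ω, p y ω * (p y ω / p y' ω) ^ a ≤ δ * Real.exp (a * ε)) ∧
      ∀ y i, ∑ ω, p y ω * ∑ t, ‖queryGap F y (st ω t) i‖ ^ 2 ≤ T * (14 * α ^ 2) := by
  -- Coordinates bounded by `α / 4` give gap coordinates at most `α / 2`, hence biases at most `1 /
  -- 2`. The choice of `b` makes the selection loss `log |ι| / b` at most `α`.
  set s : ℝ := 1 / α with hs
  set b : ℝ := Λ / α with hb
  have hs0 : 0 < s := by positivity
  have hb0 : 0 < b := by positivity
  have hsgap : ∀ y θ i c, |(s • queryGap F y θ i) c| ≤ 1 / 2 := by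
    intro y θ i c
    have h := mul_le_mul_of_nonneg_left (abs_queryGap_le hn hF y θ i c) hs0.le
    rw [PiLp.smul_apply, smul_eq_mul, abs_mul, abs_of_pos hs0]
    refine h.trans (le_of_eq ?_)
    rw [hs]
    field_simp
    norm_num
  set upd := updateWeights F (1 / (G ^ 2 * s))
  have hKpos := fun y => roundProb_pos (b := b) hsgap y
  have hK1 := fun y => sum_roundProb (F := F) (b := b) (s := s) y
  -- Zero log-weights are the uniform start. States are functions of the released transcript, so
  -- both neighbors share them.
  refine ⟨Fin T → Σ i, (κ i → Bool), inferInstance,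
    fun y => transcriptProb upd (roundProb F b s y) T (fun _ _ => 0),
    transcriptState upd T (fun _ _ => 0),
    fun y => transcriptProb_pos (hKpos y) T _, fun y => sum_transcriptProb (hK1 y) T _, ?_, ?_⟩
  · rintro y y' ⟨j₀, hy⟩
    refine (sum_transcriptProb_div_rpow_le (hKpos y) (hKpos y')
      (fun θ => sum_roundProb_div_rpow_le hsgap hG hb0.le hy θ ha) T _).trans ?_
    rw [← Real.exp_log hδ, ← Real.exp_add]
    exact Real.exp_le_exp.2 hpriv
  · intro y i
    have h := sum_transcriptProb_mul_sum_le (hKpos y) (hK1 y) (crossEntropy_nonneg y)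
      (sum_roundProb_mul_crossEntropy_le hsgap hG hG0 hs0 hb0 hn y i) T (fun _ _ => 0)
    rw [crossEntropy_zero hn] at h
    have hβ : (Real.log (Fintype.card ι) / b) ^ 2 ≤ α ^ 2 := by
      refine pow_le_pow_left₀ (div_nonneg (Real.log_nonneg ?_) hb0.le) ?_ 2
      · exact_mod_cast Fintype.card_pos
      · rw [div_le_iff₀ hb0, hb, mul_div_cancel₀ _ hα.ne']
        exact hι
    have hs2 : 4 / s ^ 2 = 4 * α ^ 2 := by rw [hs]; field_simp
    set β := (Real.log (Fintype.card ι) / b) ^ 2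
    set p := transcriptProb upd (roundProb F b s y) T (fun _ _ => 0)
    set R : (Fin T → Σ i, (κ i → Bool)) → ℝ := fun ω =>
      ∑ t, ‖queryGap F y (transcriptState upd T (fun _ _ => 0) ω t) i‖ ^ 2 with hR
    have e : ∀ ω, ∑ t, (‖queryGap F y (transcriptState upd T (fun _ _ => 0) ω t) i‖ ^ 2 / 2 - β
        - 4 / s ^ 2) / (2 * G ^ 2) = (R ω / 2 - T * (β + 4 * α ^ 2)) / (2 * G ^ 2) := by
      intro ω
      rw [hs2, ← Finset.sum_div, Finset.sum_sub_distrib, Finset.sum_sub_distrib, ← Finset.sum_div]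
      simp
      ring
    change ∑ ω, p ω * ∑ t, (‖queryGap F y (transcriptState upd T (fun _ _ => 0) ω t) i‖ ^ 2 / 2
      - β - 4 / s ^ 2) / (2 * G ^ 2) ≤ _ at h
    have hp1 : ∑ ω, p ω = 1 := sum_transcriptProb (hK1 y) T _
    simp only [e, mul_div_assoc', mul_sub, ← Finset.sum_div, Finset.sum_sub_distrib,
      ← Finset.sum_mul, hp1, one_mul] at h
    rw [div_le_iff₀ (by positivity)] at h
    change ∑ ω, p ω * R ω ≤ _
    have hTβ : (T : ℝ) * β ≤ T * α ^ 2 := mul_le_mul_of_nonneg_left hβ (by positivity)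
    -- The `14` is `4` from the initial potential `log |Y|` plus `10` from selection loss and sign
    -- noise.
    linarith

/-! ### Strongly convex functions on closed convex sets -/

section Convex

variable {d : ℕ} {W : Set (EuclideanSpace ℝ (Fin d))} {μ lam G : ℝ}
  {f : EuclideanSpace ℝ (Fin d) → ℝ} {g : EuclideanSpace ℝ (Fin d) → EuclideanSpace ℝ (Fin d)}

/-- `g` is a `lam`-Lipschitz field of subgradients of norm at most `G` witnessing the `μ`-strong
convexity of `f` on `W`. -/
structure IsStrongSubgradient (μ lam G : ℝ) (W : Set (EuclideanSpace ℝ (Fin d)))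
    (f : EuclideanSpace ℝ (Fin d) → ℝ)
    (g : EuclideanSpace ℝ (Fin d) → EuclideanSpace ℝ (Fin d)) : Prop where
  lower : ∀ w ∈ W, ∀ w' ∈ W, f w' + inner ℝ (g w') (w - w') + μ / 2 * ‖w - w'‖ ^ 2 ≤ f w
  lipschitz : ∀ w ∈ W, ∀ w' ∈ W, ‖g w - g w'‖ ≤ lam * ‖w - w'‖
  norm_le : ∀ w ∈ W, ‖g w‖ ≤ G

/-- A point of a convex set can be perturbed so that every direction of the affine span becomes
feasible. -/
lemma exists_feasible_direction (hW : Convex ℝ W) (hne : W.Nonempty) :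
    ∃ z ∈ W, ∀ w ∈ W, ∀ u ∈ vectorSpan ℝ W, ∀ t ∈ Set.Ioc (0 : ℝ) 1, ∃ τ : ℝ, 0 < τ ∧
      w + t • (z - w) + τ • u ∈ W := by
  obtain ⟨z, hz⟩ := (intrinsicInterior_nonempty hW).2 hne
  have hzW := intrinsicInterior_subset hz
  refine ⟨z, hzW, fun w hw u hu t ht => ?_⟩
  obtain ⟨z', hz', rfl⟩ := mem_intrinsicInterior.1 hz
  have hu' : u ∈ (affineSpan ℝ W).direction := by rwa [direction_affineSpan]
  have hmem : ∀ τ : ℝ, (z' : EuclideanSpace ℝ (Fin d)) + τ • u ∈ affineSpan ℝ W := by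
    intro τ
    rw [add_comm]
    exact AffineSubspace.vadd_mem_of_mem_direction (Submodule.smul_mem _ _ hu') z'.2
  let γ : ℝ → affineSpan ℝ W := fun τ => ⟨z' + τ • u, hmem τ⟩
  have hγ : Continuous γ := by
    refine Continuous.subtype_mk ?_ _
    fun_prop
  have hγ0 : γ 0 = z' := by ext1; simp [γ]
  have hnhds : ∀ᶠ τ in nhds (0 : ℝ), γ τ ∈ interior ((↑) ⁻¹' W : Set (affineSpan ℝ W)) :=
    hγ.continuousAt.eventually_mem (by
      rw [hγ0]
      exact isOpen_interior.mem_nhds hz')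
  obtain ⟨τ, hτ, hτ0⟩ := ((hnhds.filter_mono nhdsWithin_le_nhds).and
    (self_mem_nhdsWithin : Set.Ioi (0 : ℝ) ∈ nhdsWithin 0 (Set.Ioi 0))).exists
  have hτW : (z' : EuclideanSpace ℝ (Fin d)) + τ • u ∈ W :=
    interior_subset (s := ((↑) ⁻¹' W : Set (affineSpan ℝ W))) hτ
  -- The point is the convex combination of `w` and `z + τ • u` with weight `t`.
  refine ⟨t * τ, mul_pos ht.1 hτ0, ?_⟩
  have := hW hw hτW (sub_nonneg.2 ht.2) ht.1.le (by ring)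
  convert this using 1
  module

/-- When `W` has empty interior, the part of a gradient normal to its span is arbitrary and may be
large, so it is projected away. The norm bound then follows by moving along the projected gradient
from points slightly pushed into the relative interior, and letting the push tend to zero. -/
lemma IsStronglyConvexSmooth.exists_isStrongSubgradient (hW : Convex ℝ W) (hne : W.Nonempty)
    (hlip : IsLipschitzLoss G W f) (hμ : 0 ≤ μ) (hG : 0 ≤ G)
    (hf : IsStronglyConvexSmooth μ lam W f) : ∃ g, IsStrongSubgradient μ lam G W f g := by
  obtain ⟨g, -, hlow, hsm⟩ := hf
  set V := vectorSpan ℝ W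
  have hinner : ∀ w u, u ∈ V → inner ℝ (V.starProjection (g w)) u = inner ℝ (g w) u := by
    intro w u hu
    rw [Submodule.inner_starProjection_left_eq_right, Submodule.starProjection_eq_self_iff.2 hu]
  refine ⟨fun w => V.starProjection (g w), fun w hw w' hw' => ?_, fun w hw w' hw' => ?_,
    fun w hw => ?_⟩
  · rw [hinner w' (w - w') (vsub_mem_vectorSpan ℝ hw hw')]
    exact hlow w hw w' hw'
  · rw [← map_sub]
    exact (Submodule.norm_starProjection_apply_le _ _).trans (hsm w hw w' hw')
  · obtain ⟨z, hz, hdir⟩ := exists_feasible_direction hW hne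
    set u := V.starProjection (g w) with hu
    have huV : u ∈ V := Submodule.starProjection_apply_mem _ _
    have hself : inner ℝ (g w) u = ‖u‖ ^ 2 := by
      rw [← hinner w u huV, ← hu, real_inner_self_eq_norm_sq]
    have key : ∀ t ∈ Set.Ioc (0 : ℝ) 1, ‖u‖ ^ 2 ≤ G * ‖u‖ + t * (lam * ‖z - w‖ * ‖u‖) := by
      intro t ht
      obtain ⟨τ, hτ, hmem⟩ := hdir w hw u huV t ht
      set wt := w + t • (z - w) with hwt
      have hwtW : wt ∈ W := by
        have := hW hw hz (sub_nonneg.2 ht.2) ht.1.le (by ring)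
        convert this using 1
        rw [hwt]
        module
      have h1 := hlow _ hmem _ hwtW
      have h2 := (abs_le.1 (hlip _ hmem _ hwtW)).2
      simp only [add_sub_cancel_left, norm_smul, Real.norm_eq_abs, abs_of_pos hτ,
        real_inner_smul_right] at h1 h2
      have h3 : inner ℝ (g wt) u ≤ G * ‖u‖ := by
        have : 0 ≤ μ / 2 * (τ * ‖u‖) ^ 2 := by positivity
        refine le_of_mul_le_mul_left ?_ hτ
        linarith
      have h4 : ‖g w - g wt‖ ≤ lam * (t * ‖z - w‖) := by
        have := hsm w hw wt hwtW
        rwa [hwt, sub_add_cancel_left, norm_neg, norm_smul, Real.norm_eq_abs,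
          abs_of_pos ht.1] at this
      have h5 : inner ℝ (g w - g wt) u ≤ lam * (t * ‖z - w‖) * ‖u‖ :=
        (real_inner_le_norm _ _).trans (mul_le_mul_of_nonneg_right h4 (norm_nonneg _))
      rw [inner_sub_left, hself] at h5
      linarith
    have hlim : ‖u‖ ^ 2 ≤ G * ‖u‖ := by
      have ht : Filter.Tendsto (fun t : ℝ => G * ‖u‖ + t * (lam * ‖z - w‖ * ‖u‖))
          (nhdsWithin 0 (Set.Ioi 0)) (nhds (G * ‖u‖ + 0 * (lam * ‖z - w‖ * ‖u‖))) :=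
        (Continuous.tendsto (by fun_prop) 0).mono_left nhdsWithin_le_nhds
      rw [zero_mul, add_zero] at ht
      exact ge_of_tendsto ht (Filter.eventually_of_mem
        (Ioc_mem_nhdsGT (zero_lt_one' ℝ)) key)
    by_contra hlt
    nlinarith [not_le.1 hlt]

namespace IsStrongSubgradient

lemma weighted_sum {X : Type*} [Fintype X] {h : X → ℝ} (hh : ∀ x, 0 ≤ h x) (hh1 : ∑ x, h x = 1)
    {f : X → EuclideanSpace ℝ (Fin d) → ℝ}
    {g : X → EuclideanSpace ℝ (Fin d) → EuclideanSpace ℝ (Fin d)}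
    (hfg : ∀ x, IsStrongSubgradient μ lam G W (f x) (g x)) :
    IsStrongSubgradient μ lam G W (fun w => ∑ x, h x * f x w) (fun w => ∑ x, h x • g x w) where
  lower w hw w' hw' := by
    have : ∑ x, h x * (f x w' + inner ℝ (g x w') (w - w') + μ / 2 * ‖w - w'‖ ^ 2)
        ≤ ∑ x, h x * f x w :=
      Finset.sum_le_sum fun x _ => mul_le_mul_of_nonneg_left ((hfg x).lower w hw w' hw') (hh x)
    simpa only [mul_add, Finset.sum_add_distrib, ← Finset.sum_mul, hh1, one_mul, sum_inner,
      real_inner_smul_left] using this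
  lipschitz w hw w' hw' := by
    rw [← Finset.sum_sub_distrib]
    calc _ ≤ ∑ x, h x * (lam * ‖w - w'‖) := norm_sum_le_of_le _ fun x _ => by
          rw [← smul_sub, norm_smul, Real.norm_eq_abs, abs_of_nonneg (hh x)]
          exact mul_le_mul_of_nonneg_left ((hfg x).lipschitz w hw w' hw') (hh x)
      _ = _ := by rw [← Finset.sum_mul, hh1, one_mul]
  norm_le w hw := by
    calc _ ≤ ∑ x, h x * G := norm_sum_le_of_le _ fun x _ => by
          rw [norm_smul, Real.norm_eq_abs, abs_of_nonneg (hh x)]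
          exact mul_le_mul_of_nonneg_left ((hfg x).norm_le w hw) (hh x)
      _ = _ := by rw [← Finset.sum_mul, hh1, one_mul]

variable (hfg : IsStrongSubgradient μ lam G W f g)
include hfg

lemma sub_le (hμ : 0 ≤ μ) {w w' : EuclideanSpace ℝ (Fin d)} (hw : w ∈ W) (hw' : w' ∈ W) :
    f w - f w' ≤ G * ‖w - w'‖ := by
  have h1 := hfg.lower w' hw' w hw
  have h2 := neg_le_of_abs_le ((abs_real_inner_le_norm (g w) (w' - w)).trans
    (mul_le_mul_of_nonneg_right (hfg.norm_le w hw) (norm_nonneg _)))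
  rw [norm_sub_rev] at h2
  have : 0 ≤ μ / 2 * ‖w' - w‖ ^ 2 := by positivity
  linarith

lemma exists_minimizer (hμ : 0 < μ) (hclosed : IsClosed W) (hne : W.Nonempty) :
    ∃ w₀ ∈ W, ∀ w ∈ W, f w₀ ≤ f w := by
  obtain ⟨w₁, hw₁⟩ := hne
  have hG : 0 ≤ G := (norm_nonneg _).trans (hfg.norm_le w₁ hw₁)
  have hcont : ContinuousOn f W := by
    refine (LipschitzOnWith.of_dist_le_mul (K := G.toNNReal) fun x hx y hy => ?_).continuousOn
    rw [Real.coe_toNNReal _ hG, Real.dist_eq, dist_eq_norm, abs_le]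
    have := hfg.sub_le hμ.le hx hy
    have h' := hfg.sub_le hμ.le hy hx
    rw [norm_sub_rev] at h'
    constructor <;> linarith
  have hr : 0 ≤ 2 * G / μ := by positivity
  obtain ⟨w₀, hw₀, hmin⟩ := ((isCompact_closedBall w₁ (2 * G / μ)).inter_left
    hclosed).exists_isMinOn ⟨w₁, hw₁, Metric.mem_closedBall_self hr⟩
    (hcont.mono Set.inter_subset_left)
  refine ⟨w₀, hw₀.1, fun w hw => ?_⟩
  -- Outside this ball the quadratic term beats the linear one, so a minimizer on the compact part
  -- is global.
  by_cases hball : w ∈ Metric.closedBall w₁ (2 * G / μ)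
  · exact hmin ⟨hw, hball⟩
  · have h1 : f w₀ ≤ f w₁ := hmin ⟨hw₁, Metric.mem_closedBall_self hr⟩
    have h2 := hfg.lower w hw w₁ hw₁
    have h3 := neg_le_of_abs_le ((abs_real_inner_le_norm (g w₁) (w - w₁)).trans
      (mul_le_mul_of_nonneg_right (hfg.norm_le w₁ hw₁) (norm_nonneg _)))
    rw [Metric.mem_closedBall, dist_eq_norm, not_le, div_lt_iff₀ hμ] at hball
    have := norm_nonneg (w - w₁)
    nlinarith

lemma inner_nonneg_of_minimizer (hW : Convex ℝ W) (hμ : 0 ≤ μ)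
    {w₀ : EuclideanSpace ℝ (Fin d)} (hw₀ : w₀ ∈ W) (hmin : ∀ w ∈ W, f w₀ ≤ f w)
    {w : EuclideanSpace ℝ (Fin d)} (hw : w ∈ W) : 0 ≤ inner ℝ (g w₀) (w - w₀) := by
  have key : ∀ t ∈ Set.Ioc (0 : ℝ) 1,
      -(t * (lam * ‖w - w₀‖ * ‖w - w₀‖)) ≤ inner ℝ (g w₀) (w - w₀) := by
    intro t ht
    set z := w₀ + t • (w - w₀) with hz
    have hzW : z ∈ W := by
      have := hW hw₀ hw (sub_nonneg.2 ht.2) ht.1.le (by ring)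
      convert this using 1
      rw [hz]
      module
    have h1 := hfg.lower w₀ hw₀ z hzW
    have h2 := hmin z hzW
    have e : w₀ - z = -(t • (w - w₀)) := by rw [hz]; abel
    have h4 := hfg.lipschitz z hzW w₀ hw₀
    rw [← norm_neg (z - w₀), neg_sub, e, norm_neg, norm_smul, Real.norm_eq_abs,
      abs_of_pos ht.1] at h4
    rw [e, inner_neg_right, real_inner_smul_right] at h1
    have h3 : 0 ≤ inner ℝ (g z) (w - w₀) := by
      have : 0 ≤ μ / 2 * ‖-(t • (w - w₀))‖ ^ 2 := by positivity
      refine nonneg_of_mul_nonneg_right ?_ ht.1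
      linarith
    have h5 := (real_inner_le_norm (g z - g w₀) (w - w₀)).trans
      (mul_le_mul_of_nonneg_right h4 (norm_nonneg _))
    rw [inner_sub_left] at h5
    linarith
  have ht : Filter.Tendsto (fun t : ℝ => -(t * (lam * ‖w - w₀‖ * ‖w - w₀‖)))
      (nhdsWithin 0 (Set.Ioi 0)) (nhds (-(0 * (lam * ‖w - w₀‖ * ‖w - w₀‖)))) :=
    (Continuous.tendsto (by fun_prop) 0).mono_left nhdsWithin_le_nhds
  rw [zero_mul, neg_zero] at ht
  exact le_of_tendsto ht (Filter.eventually_of_mem (Ioc_mem_nhdsGT (zero_lt_one' ℝ)) key)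

/-- The strong convexity bound at `w₀` with `v` subtracted from the gradient, followed by Young's
inequality. With `v` the synthetic gradient at its minimizer `w₀`, a gradient gap becomes an excess
risk bound; with `v = 0` it gives the a priori bound. -/
lemma sub_norm_sq_le (hμ : 0 < μ) {w₀ w v : EuclideanSpace ℝ (Fin d)} (hw₀ : w₀ ∈ W)
    (hw : w ∈ W) (hv : 0 ≤ inner ℝ v (w - w₀)) :
    f w₀ - ‖g w₀ - v‖ ^ 2 / (2 * μ) ≤ f w := by
  have h1 := hfg.lower w hw w₀ hw₀
  have h2 := neg_le_of_abs_le (abs_real_inner_le_norm (g w₀ - v) (w - w₀))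
  rw [inner_sub_left] at h2
  have h3 : ‖g w₀ - v‖ * ‖w - w₀‖ ≤ ‖g w₀ - v‖ ^ 2 / (2 * μ) + μ / 2 * ‖w - w₀‖ ^ 2 := by
    rw [← sub_nonneg]
    have : ‖g w₀ - v‖ ^ 2 / (2 * μ) + μ / 2 * ‖w - w₀‖ ^ 2 - ‖g w₀ - v‖ * ‖w - w₀‖
        = (‖g w₀ - v‖ - μ * ‖w - w₀‖) ^ 2 / (2 * μ) := by
      field_simp
      ring
    rw [this]
    positivity
  linarith

/-- Adding the strong convexity inequalities at the two points compares monotonicity of `g` with its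
Lipschitz bound. -/
lemma le_of_ne {w w' : EuclideanSpace ℝ (Fin d)} (hw : w ∈ W)
    (hw' : w' ∈ W) (hne : w ≠ w') : μ ≤ lam := by
  have h1 := hfg.lower w hw w' hw'
  have h2 := hfg.lower w' hw' w hw
  have h3 := (real_inner_le_norm (g w - g w') (w - w')).trans
    (mul_le_mul_of_nonneg_right (hfg.lipschitz w hw w' hw') (norm_nonneg _))
  rw [← neg_sub w w', norm_neg, inner_neg_right] at h2
  rw [inner_sub_left] at h3
  have hpos : 0 < ‖w - w'‖ := norm_pos_iff.2 (sub_ne_zero.2 hne)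
  refine le_of_mul_le_mul_right ?_ (pow_pos hpos 2)
  linarith

lemma map_average_le (hμ : 0 ≤ μ) {T : ℕ} (hT : 0 < T) {w : Fin T → EuclideanSpace ℝ (Fin d)}
    (hw : ∀ t, w t ∈ W) (hmem : (1 / (T : ℝ)) • ∑ t, w t ∈ W) :
    f ((1 / (T : ℝ)) • ∑ t, w t) ≤ (1 / (T : ℝ)) * ∑ t, f (w t) := by
  set v := (1 / (T : ℝ)) • ∑ t, w t with hv
  have hT' : (0 : ℝ) < T := by exact_mod_cast hT
  have h1 : ∀ t, f v + inner ℝ (g v) (w t - v) ≤ f (w t) := fun t => by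
    have := hfg.lower _ (hw t) v hmem
    have : 0 ≤ μ / 2 * ‖w t - v‖ ^ 2 := by positivity
    linarith
  have h2 := Finset.sum_le_sum fun t (_ : t ∈ Finset.univ) => h1 t
  rw [Finset.sum_add_distrib, ← inner_sum, Finset.sum_sub_distrib] at h2
  have h3 : ∑ t, w t - ∑ _t : Fin T, v = 0 := by
    rw [Finset.sum_const, Finset.card_univ, Fintype.card_fin, ← Nat.cast_smul_eq_nsmul ℝ, hv,
      smul_smul, mul_one_div_cancel hT'.ne', one_smul, sub_self]
  rw [h3, inner_zero_right, add_zero, Finset.sum_const, Finset.card_univ, Fintype.card_fin,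
    nsmul_eq_mul] at h2
  rw [one_div_mul_eq_div, le_div_iff₀ hT']
  linarith

end IsStrongSubgradient

end Convex

/-! ### From minimization to gradient queries -/

/-- The isometric embedding that spreads each coordinate evenly over `N` copies of it. -/
def spread {d : ℕ} (N : ℕ) :
    EuclideanSpace ℝ (Fin d) →ₗ[ℝ] EuclideanSpace ℝ (Fin d × Fin N) where
  toFun u := WithLp.toLp 2 fun c => u c.1 / √N
  map_add' u v := by ext c; simp [add_div]
  map_smul' r u := by ext c; simp [mul_div_assoc]

lemma spread_apply {d N : ℕ} (u : EuclideanSpace ℝ (Fin d)) (c : Fin d × Fin N) :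
    spread N u c = u c.1 / √N := rfl

lemma norm_spread {d N : ℕ} (hN : 0 < N) (u : EuclideanSpace ℝ (Fin d)) :
    ‖spread N u‖ = ‖u‖ := by
  rw [← sq_eq_sq₀ (norm_nonneg _) (norm_nonneg _), EuclideanSpace.real_norm_sq_eq,
    EuclideanSpace.real_norm_sq_eq, Fintype.sum_prod_type]
  refine Finset.sum_congr rfl fun c _ => ?_
  have : (N : ℝ) ≠ 0 := by exact_mod_cast hN.ne'
  simp only [spread_apply, div_pow, Real.sq_sqrt (Nat.cast_nonneg N), Finset.sum_const,
    Finset.card_univ, Fintype.card_fin, nsmul_eq_mul]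
  field_simp

lemma abs_spread_le {d N : ℕ} {G B : ℝ} (hB : 0 < B) (hN : (G / B) ^ 2 ≤ N) (hN0 : 0 < N)
    {u : EuclideanSpace ℝ (Fin d)} (hu : ‖u‖ ≤ G) (c : Fin d × Fin N) : |spread N u c| ≤ B := by
  have h1 : |u c.1| ≤ G := (PiLp.norm_apply_le u c.1).trans hu
  have h2 : G / B ≤ √N := Real.le_sqrt_of_sq_le hN
  have h3 : 0 < √(N : ℝ) := Real.sqrt_pos.2 (by exact_mod_cast hN0)
  rw [spread_apply, abs_div, abs_of_pos h3, div_le_iff₀ h3]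
  rw [div_le_iff₀ hB] at h2
  linarith

/-- For fixed public data, a private mechanism solving several strongly convex problems. -/
theorem exists_private_minimizer {Y : Type*} [Fintype Y] [Nonempty Y] {n m T : ℕ} [NeZero m]
    {d : Fin m → ℕ} {W : ∀ i, Set (EuclideanSpace ℝ (Fin (d i)))}
    {f : ∀ i, Fin n → Y → EuclideanSpace ℝ (Fin (d i)) → ℝ}
    {g : ∀ i, Fin n → Y → EuclideanSpace ℝ (Fin (d i)) → EuclideanSpace ℝ (Fin (d i))}
    {G μ lam α Λ ε δ a : ℝ} (hn : 0 < n) (hT0 : 0 < T) (hG0 : 0 < G) (hμ : 0 < μ)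
    (hW : ∀ i, (W i).Nonempty ∧ IsClosed (W i) ∧ Convex ℝ (W i))
    (hfg : ∀ i j z, IsStrongSubgradient μ lam G (W i) (f i j z) (g i j z))
    (hα : 0 < α) (hΛ : 0 < Λ) (ha : 0 ≤ a) (hδ : 0 < δ)
    (hm : Real.log m ≤ Λ) (hT : G ^ 2 * Real.log (Fintype.card Y) ≤ T * α ^ 2)
    (hpriv : T * ((a ^ 2 + a) * (((Λ / α) ^ 2 / 2 + 2 * (1 / α) ^ 2) * (2 * G / n) ^ 2))
      ≤ Real.log δ + a * ε) :
    ∃ A : (Fin n → Y) → ProbabilityMeasure (∀ i, W i),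
      (∀ y y' : Fin n → Y, (∃ j₀, ∀ j, j ≠ j₀ → y j = y' j) → ∀ S, MeasurableSet S →
        (A y : Measure (∀ i, W i)) S
          ≤ ENNReal.ofReal (Real.exp ε) * (A y' : Measure (∀ i, W i)) S + ENNReal.ofReal δ) ∧
      ∀ y i, ∀ v ∈ W i,
        Integrable (fun w => (1 / (n : ℝ)) * ∑ j, f i j (y j) (w i)
          - (1 / (n : ℝ)) * ∑ j, f i j (y j) v) (A y : Measure (∀ i, W i)) ∧
        ∫ w, ((1 / (n : ℝ)) * ∑ j, f i j (y j) (w i) - (1 / (n : ℝ)) * ∑ j, f i j (y j) v)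
          ∂(A y : Measure (∀ i, W i)) ≤ 7 * α ^ 2 / μ := by
  have hn' : (0 : ℝ) < n := by exact_mod_cast hn
  have hT' : (0 : ℝ) < T := by exact_mod_cast hT0
  have hu0 : ∀ _j : Fin n, (0 : ℝ) ≤ 1 / n := fun _ => by positivity
  have hu1 : ∑ _j : Fin n, (1 : ℝ) / n = 1 := by simp [hn'.ne']
  have hsyn : ∀ (θ : Fin n → Y → ℝ) i, IsStrongSubgradient μ lam G (W i)
      (fun w => ∑ j, (1 / (n : ℝ)) * ∑ z, softmax (θ j) z * f i j z w)
      (fun w => ∑ j, (1 / (n : ℝ)) • ∑ z, softmax (θ j) z • g i j z w) := fun θ i =>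
    IsStrongSubgradient.weighted_sum hu0 hu1 fun j =>
      IsStrongSubgradient.weighted_sum (fun z => (softmax_pos (θ j) z).le) (sum_softmax (θ j))
        (hfg i j)
  have htrue : ∀ (y : Fin n → Y) i, IsStrongSubgradient μ lam G (W i)
      (fun w => ∑ j, (1 / (n : ℝ)) * f i j (y j) w)
      (fun w => ∑ j, (1 / (n : ℝ)) • g i j (y j) w) := fun y i =>
    IsStrongSubgradient.weighted_sum hu0 hu1 fun j => hfg i j (y j)
  choose wmin hwmin hmin using fun θ i =>
    (hsyn θ i).exists_minimizer hμ (hW i).2.1 (hW i).1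
  -- Enough copies make every coordinate of the spread gradient at most `α / 4`. Their number is
  -- harmless, since all estimates depend on norms only.
  obtain ⟨N, hN⟩ := exists_nat_ge ((G / (α / 4)) ^ 2)
  have hN0 : 0 < N := by
    have : 0 < (G / (α / 4)) ^ 2 := by positivity
    exact_mod_cast this.trans_le hN
  set F : (Fin n → Y → ℝ) → ∀ i, Fin n → Y → EuclideanSpace ℝ (Fin (d i) × Fin N) :=
    fun θ i j z => spread N (g i j z (wmin θ i)) with hF
  have hgap : ∀ y θ i, queryGap F y θ i
      = spread N (∑ j, (1 / (n : ℝ)) • g i j (y j) (wmin θ i)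
        - ∑ j, (1 / (n : ℝ)) • ∑ z, softmax (θ j) z • g i j z (wmin θ i)) := by
    intro y θ i
    simp only [queryGap, hF, map_sub, map_sum, map_smul, Finset.smul_sum, smul_sub,
      Finset.sum_sub_distrib]
  have hexcess : ∀ y θ i, ∀ v ∈ W i, ∑ j, (1 / (n : ℝ)) * f i j (y j) (wmin θ i)
      - ∑ j, (1 / (n : ℝ)) * f i j (y j) v ≤ ‖queryGap F y θ i‖ ^ 2 / (2 * μ) := by
    intro y θ i v hv
    have := (htrue y i).sub_norm_sq_le hμ (hwmin θ i) hv
      ((hsyn θ i).inner_nonneg_of_minimizer (hW i).2.2 hμ.le (hwmin θ i) (hmin θ i) hv)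
    rw [hgap, norm_spread hN0]
    linarith
  obtain ⟨Ω, _, p, st, hp, hp1, hdp, hutil⟩ := exists_private_multiplicative_weights
    (ε := ε) F hn hG0 hα hΛ ha hδ
    (fun θ i j z => by rw [hF, norm_spread hN0]; exact (hfg i j z).norm_le _ (hwmin θ i))
    (fun θ i j z c => abs_spread_le (by positivity) hN hN0
      ((hfg i j z).norm_le _ (hwmin θ i)) c)
    (by rwa [Fintype.card_fin]) hT hpriv
  have hout : ∀ ω i, (1 / (T : ℝ)) • ∑ t, wmin (st ω t) i ∈ W i := by
    intro ω i
    rw [Finset.smul_sum]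
    exact (hW i).2.2.sum_mem (fun _ _ => by positivity) (by simp [hT'.ne'])
      fun t _ => hwmin _ i
  set out : Ω → ∀ i, W i := fun ω i => ⟨_, hout ω i⟩ with houtdef
  refine ⟨fun y => ⟨weightedDirac (p y) out,
    isProbabilityMeasure_weightedDirac (fun ω => (hp y ω).le) (hp1 y)⟩,
    fun y y' hy S hS => weightedDirac_le_of_rpow (hp y) (hp y') ha (hdp y y' hy) hS,
    fun y i v hv => ⟨integrable_weightedDirac _, ?_⟩⟩
  change ∫ w, _ ∂(weightedDirac (p y) out) ≤ _
  rw [integral_weightedDirac fun ω => (hp y ω).le]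
  have hstep : ∀ ω, (1 / (n : ℝ)) * ∑ j, f i j (y j) (out ω i)
      - (1 / (n : ℝ)) * ∑ j, f i j (y j) v
      ≤ 1 / (T * (2 * μ)) * ∑ t, ‖queryGap F y (st ω t) i‖ ^ 2 := by
    intro ω
    have h1 := (htrue y i).map_average_le hμ.le hT0 (fun t => hwmin (st ω t) i) (hout ω i)
    have h2 := Finset.sum_le_sum fun t (_ : t ∈ Finset.univ) => hexcess y (st ω t) i v hv
    rw [Finset.sum_sub_distrib, ← Finset.sum_div, Finset.sum_const, Finset.card_univ,
      Fintype.card_fin, nsmul_eq_mul] at h2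
    simp only [← Finset.mul_sum] at h1 h2
    have h3 := mul_le_mul_of_nonneg_left h2 (one_div_pos.2 hT').le
    rw [mul_sub, ← mul_assoc (1 / (T : ℝ)) (T : ℝ), one_div_mul_cancel hT'.ne', one_mul] at h3
    refine (sub_le_sub_right h1 _).trans (h3.trans (le_of_eq ?_))
    field_simp
  calc _ ≤ ∑ ω, p y ω * (1 / (T * (2 * μ)) * ∑ t, ‖queryGap F y (st ω t) i‖ ^ 2) :=
        Finset.sum_le_sum fun ω _ => mul_le_mul_of_nonneg_left (hstep ω) (hp y ω).le
    _ = 1 / (T * (2 * μ)) * ∑ ω, p y ω * ∑ t, ‖queryGap F y (st ω t) i‖ ^ 2 := by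
        rw [Finset.mul_sum]
        exact Finset.sum_congr rfl fun _ _ => by ring
    _ ≤ 1 / (T * (2 * μ)) * (T * (14 * α ^ 2)) :=
        mul_le_mul_of_nonneg_left (hutil y i) (by positivity)
    _ = 7 * α ^ 2 / μ := by
        field_simp
        norm_num

/-! ### Parameters and degenerate cases -/

/-- The cost scales as `1 / α ^ 4`, one `1 / α ^ 2` from the number of rounds and one from the cost
per round. The constants multiply to `180`, below the `14 ^ 2 = 196` supplied by `α`. -/
lemma privacy_budget_le {G α Λ κ L ε n T : ℝ} (hG : 0 < G) (hα : 0 < α) (hΛ : 1 ≤ Λ)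
    (hκ : 1 / 2 ≤ κ) (hε : 0 < ε) (hεL : ε ≤ L) (hn : 0 < n) (hαG : α ≤ G)
    (hα2 : α ^ 2 = 14 * G ^ 2 * Λ * √(κ * L) / (ε * n)) (hT : T ≤ G ^ 2 * κ / α ^ 2 + 1) :
    T * (((2 * L / ε) ^ 2 + 2 * L / ε) *
      (((Λ / α) ^ 2 / 2 + 2 * (1 / α) ^ 2) * (2 * G / n) ^ 2)) ≤ L := by
  have hL : 0 < L := hε.trans_le hεL
  have hα4 : (α ^ 2) ^ 2 = 196 * G ^ 4 * Λ ^ 2 * (κ * L) / (ε * n) ^ 2 := by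
    rw [hα2, div_pow, mul_pow, Real.sq_sqrt (by positivity)]
    ring
  -- Since `α ≤ G` and `κ ≥ 1 / 2`, rounding up the number of rounds costs only a factor.
  have h1 : T ≤ 3 * (G ^ 2 * κ / α ^ 2) := by
    have : 1 / 2 ≤ G ^ 2 * κ / α ^ 2 := by
      rw [le_div_iff₀ (by positivity)]
      have := pow_le_pow_left₀ hα.le hαG 2
      nlinarith [pow_pos hG 2]
    linarith
  have h2 : (2 * L / ε) ^ 2 + 2 * L / ε ≤ 6 * L ^ 2 / ε ^ 2 := by
    rw [div_pow, div_add_div _ _ (by positivity) hε.ne', div_le_div_iff₀ (by positivity)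
      (by positivity)]
    have : 0 ≤ ε ^ 4 * L * (L - ε) := by
      have := sub_nonneg.2 hεL
      positivity
    have h' : 0 ≤ ε ^ 3 * L * (L - ε) := by
      have := sub_nonneg.2 hεL
      positivity
    nlinarith
  have h3 : (Λ / α) ^ 2 / 2 + 2 * (1 / α) ^ 2 ≤ 5 / 2 * Λ ^ 2 / α ^ 2 := by
    have e : (Λ / α) ^ 2 / 2 + 2 * (1 / α) ^ 2 = (Λ ^ 2 / 2 + 2) / α ^ 2 := by field_simp
    rw [e]
    gcongr
    nlinarith
  calc _ ≤ 3 * (G ^ 2 * κ / α ^ 2) * (6 * L ^ 2 / ε ^ 2 *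
        (5 / 2 * Λ ^ 2 / α ^ 2 * (2 * G / n) ^ 2)) := by gcongr
    _ = 180 * G ^ 4 * κ * L ^ 2 * Λ ^ 2 / (ε ^ 2 * n ^ 2) / (α ^ 2) ^ 2 := by
        field_simp
        ring
    _ = 180 / 196 * L := by
        rw [hα4]
        field_simp
    _ ≤ L := by linarith

lemma one_add_log_le {m n k : ℕ} {lam μ A B : ℝ} (hm : 0 < m) (hn : 0 < n) (hk : 2 ≤ k)
    (hμ : 0 < μ) (hlam : μ ≤ lam) :
    1 + Real.log m ≤ 7 * (Real.log (max 2 (m * n * lam / μ)) + Real.log (max 1 A) +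
      Real.log (Real.log k) + Real.log (max 1 B)) := by
  have hA := Real.log_nonneg (le_max_left 1 A)
  have hB := Real.log_nonneg (le_max_left 1 B)
  have h2 := Real.log_two_gt_d9
  have hm' : (1 : ℝ) ≤ m := by exact_mod_cast hm
  have hn' : (1 : ℝ) ≤ n := by exact_mod_cast hn
  have hM2 : Real.log 2 ≤ Real.log (max 2 (m * n * lam / μ)) :=
    Real.log_le_log two_pos (le_max_left _ _)
  have hMm : Real.log m ≤ Real.log (max 2 (m * n * lam / μ)) := by
    refine Real.log_le_log (by linarith) (le_max_of_le_right ?_)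
    rw [le_div_iff₀ hμ, mul_assoc]
    have : μ ≤ n * lam := by nlinarith
    gcongr
  have hk' : Real.log 2 ≤ Real.log k := Real.log_le_log two_pos (by exact_mod_cast hk)
  -- For `k = 2` this iterated logarithm is negative; the first logarithm, at least `log 2`,
  -- outweighs it.
  have hll : 1 - (Real.log 2)⁻¹ ≤ Real.log (Real.log k) :=
    (Real.one_sub_inv_le_log_of_pos (by linarith)).trans
      (Real.log_le_log (by linarith) hk')
  have hinv : (Real.log 2)⁻¹ ≤ 1.4428 := by
    rw [inv_le_comm₀ (by linarith) (by norm_num)]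
    norm_num
    linarith
  norm_num at hinv h2
  linarith

lemma IsStronglyConvexSmooth.exists_minimizer_empiricalRisk {Xpub Xpriv : Type*} {n d : ℕ}
    {W : Set (EuclideanSpace ℝ (Fin d))} {l : EuclideanSpace ℝ (Fin d) → Xpub × Xpriv → ℝ}
    {G μ lam : ℝ} (hn : 0 < n) (hG : 0 ≤ G) (hμ : 0 < μ)
    (hW : W.Nonempty ∧ IsClosed W ∧ Convex ℝ W) (hlip : ∀ x, IsLipschitzLoss G W (fun w => l w x))
    (hsc : ∀ x, IsStronglyConvexSmooth μ lam W (fun w => l w x)) (D : Dataset Xpub Xpriv n) :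
    ∃ v ∈ W, (∀ w, excessRisk W l D w = empiricalRisk l D w - empiricalRisk l D v) ∧
      ∀ w ∈ W, excessRisk W l D w ≤ G ^ 2 / (2 * μ) := by
  choose g hg using fun x => (hsc x).exists_isStrongSubgradient hW.2.2 hW.1 (hlip x) hμ.le hG
  have hn' : (n : ℝ) ≠ 0 := by exact_mod_cast hn.ne'
  have hrisk : IsStrongSubgradient μ lam G W (empiricalRisk l D)
      (fun w => ∑ j, (1 / (n : ℝ)) • g (D j) w) := by
    have := IsStrongSubgradient.weighted_sum (h := fun _ : Fin n => 1 / (n : ℝ))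
      (fun _ => by positivity) (by simp [hn']) fun j => hg (D j)
    simp only [← Finset.mul_sum] at this
    exact this
  obtain ⟨v, hv, hmin⟩ := hrisk.exists_minimizer hμ hW.2.1 hW.1
  have : Nonempty W := hW.1.to_subtype
  have hinf : ⨅ w' : W, empiricalRisk l D w' = empiricalRisk l D v :=
    le_antisymm (ciInf_le ⟨_, by rintro _ ⟨w, rfl⟩; exact hmin w w.2⟩ (⟨v, hv⟩ : W))
      (le_ciInf fun w => hmin w w.2)
  refine ⟨v, hv, fun w => by rw [excessRisk, hinf], fun w hw => ?_⟩
  rw [excessRisk, hinf]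
  have h1 := hrisk.sub_norm_sq_le hμ (v := 0) hw hv (by simp)
  rw [sub_zero] at h1
  have h2 := pow_le_pow_left₀ (norm_nonneg _) (hrisk.norm_le w hw) 2
  have h3 : ‖∑ j, (1 / (n : ℝ)) • g (D j) w‖ ^ 2 / (2 * μ) ≤ G ^ 2 / (2 * μ) := by gcongr
  linarith

/-- A deterministic output that agrees on neighbors is private. This serves every case where no
noise is needed. -/
lemma exists_const_mechanism {Xpub Xpriv : Type*} {n m : ℕ} {d : Fin m → ℕ}
    {W : ∀ i : Fin m, Set (EuclideanSpace ℝ (Fin (d i)))}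
    {l : ∀ i : Fin m, EuclideanSpace ℝ (Fin (d i)) → Xpub × Xpriv → ℝ} {ε δ : ℝ}
    (hε : 0 < ε) {B : ℝ} (w : Dataset Xpub Xpriv n → ∀ i, W i)
    (hw : ∀ D D', Neighbors D D' → w D = w D')
    (hB : ∀ D i, excessRisk (W i) (l i) D (w D i) ≤ B) :
    ∃ A : Mechanism Xpub Xpriv n (∀ i : Fin m, W i), IsSemiSensitiveDP ε δ A ∧
      ∀ (D : Dataset Xpub Xpriv n) (i : Fin m),
        Integrable (fun w => excessRisk (W i) (l i) D (w i)) (A D : Measure (∀ i, W i)) ∧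
        ∫ w, excessRisk (W i) (l i) D (w i) ∂(A D : Measure (∀ i, W i)) ≤ B := by
  refine ⟨fun D => ⟨Measure.dirac (w D), inferInstance⟩, fun D D' hD S _ => ?_,
    fun D i => ⟨integrable_dirac (by simp), ?_⟩⟩
  · change Measure.dirac (w D) S ≤ _ * Measure.dirac (w D') S + _
    rw [hw D D' hD]
    refine le_add_right (le_mul_of_one_le_left zero_le ?_)
    rw [← ENNReal.ofReal_one]
    exact ENNReal.ofReal_le_ofReal (Real.one_le_exp hε.le)
  · change ∫ w, _ ∂(Measure.dirac (w D)) ≤ B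
    rw [integral_dirac]
    exact hB D i

end SemiSensitive

end

/-! ### Choice of parameters and assembly -/

open SemiSensitive in
theorem mainTheorem2 :
    ∃ C : ℝ, 0 < C ∧
      ∀ (Xpub : Type*) (Xpriv : Type*) [Fintype Xpriv] (n m : ℕ) (d : Fin m → ℕ)
        (W : ∀ i : Fin m, Set (EuclideanSpace ℝ (Fin (d i))))
        (l : ∀ i : Fin m, EuclideanSpace ℝ (Fin (d i)) → Xpub × Xpriv → ℝ)
        (G μ lam ε δ : ℝ),
        0 < n → 0 < G → 0 < μ → 0 < lam →
        (∀ i, (W i).Nonempty ∧ IsClosed (W i) ∧ Convex ℝ (W i)) →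
        (∀ i x, SemiSensitive.IsLipschitzLoss G (W i) (fun w => l i w x)) →
        (∀ i x, SemiSensitive.IsStronglyConvexSmooth μ lam (W i) (fun w => l i w x)) →
        0 < δ → δ < 1 / 2 → 0 < ε → ε < Real.log (1 / δ) →
        ∃ A : SemiSensitive.Mechanism Xpub Xpriv n (∀ i : Fin m, W i),
          SemiSensitive.IsSemiSensitiveDP ε δ A ∧
          ∀ (D : SemiSensitive.Dataset Xpub Xpriv n) (i : Fin m),
            Integrable (fun w => SemiSensitive.excessRisk (W i) (l i) D (w i))
              (A D : Measure (∀ i : Fin m, W i)) ∧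
            ∫ w, SemiSensitive.excessRisk (W i) (l i) D (w i)
                ∂(A D : Measure (∀ i : Fin m, W i)) ≤
              C * (G ^ 2 / μ *
                (Real.sqrt (Real.log (Fintype.card Xpriv) * Real.log (1 / δ)) *
                  (Real.log (max 2 (m * n * lam / μ)) + Real.log (max 1 (Real.log (G / μ))) +
                    Real.log (Real.log (Fintype.card Xpriv)) +
                    Real.log (max 1 (Real.sqrt (Real.log (1 / δ)) / ε)))) / (ε * n)) := by
  refine ⟨1000, by norm_num, ?_⟩
  intro Xpub Xpriv _ n m d W l G μ lam ε δ hn hG hμ hlam hW hlip hsc hδ hδ2 hε hεδ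
  have hn' : (0 : ℝ) < n := by exact_mod_cast hn
  choose v hv hexc hbound using fun (D : Dataset Xpub Xpriv n) i =>
    IsStronglyConvexSmooth.exists_minimizer_empiricalRisk hn hG.le hμ (hW i) (hlip i) (hsc i) D
  rcases le_or_gt (Fintype.card Xpriv) 1 with hk | hk
  · have hsub : Subsingleton Xpriv := Fintype.card_le_one_iff_subsingleton.1 hk
    have hlog : Real.log (Fintype.card Xpriv) = 0 := by
      -- The empty type is included, since `Real.log 0 = 0`.
      interval_cases Fintype.card Xpriv <;> simp
    simp only [hlog, zero_mul, Real.sqrt_zero, zero_div, mul_zero]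
    refine exists_const_mechanism hε (fun D i => ⟨v D i, hv D i⟩) (fun D D' hD => ?_)
      fun D i => by rw [hexc, sub_self]
    rw [show D = D' from funext fun j => Prod.ext (hD.1 j) (Subsingleton.elim _ _)]
  choose w₀ hw₀ using fun i => (hW i).1
  have hk2 : Real.log 2 ≤ Real.log (Fintype.card Xpriv) :=
    Real.log_le_log two_pos (by exact_mod_cast hk)
  have hk' : 1 / 2 ≤ Real.log (Fintype.card Xpriv) := by linarith [Real.log_two_gt_d9]
  -- The bound on `log m` needs `μ ≤ lam`, which requires two distinct points in some `W i`. If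
  -- there are none, all excess risks vanish.
  by_cases htriv : ∀ i, (W i).Subsingleton
  · refine exists_const_mechanism hε (fun _ i => ⟨w₀ i, hw₀ i⟩) (fun _ _ _ => rfl)
      fun D i => ?_
    have h0 : excessRisk (W i) (l i) D (w₀ i) = 0 := by
      rw [hexc, htriv i (hw₀ i) (hv D i), sub_self]
    refine h0.trans_le ?_
    have h1 := Real.log_nonneg (le_max_left 1 (Real.log (G / μ)))
    have h2 := Real.log_nonneg (le_max_left 1 (Real.sqrt (Real.log (1 / δ)) / ε))
    have h3 : Real.log 2 ≤ Real.log (max 2 (m * n * lam / μ)) :=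
      Real.log_le_log two_pos (le_max_left _ _)
    -- With all parameters one, this says that `log 2 + log (log k)` is positive.
    have h4 := one_add_log_le (A := 0) (B := 0) one_pos one_pos hk one_pos (le_refl (1 : ℝ))
    norm_num at h4
    have hsum : 0 ≤ Real.log (max 2 (m * n * lam / μ)) + Real.log (max 1 (Real.log (G / μ))) +
        Real.log (Real.log (Fintype.card Xpriv)) +
        Real.log (max 1 (Real.sqrt (Real.log (1 / δ)) / ε)) := by linarith
    positivity
  rcases isEmpty_or_nonempty Xpub with hpub | ⟨⟨x₀⟩⟩
  · exact exists_const_mechanism hε (fun _ i => ⟨w₀ i, hw₀ i⟩) (fun _ _ _ => rfl)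
      fun D => isEmptyElim (D ⟨0, hn⟩).1
  have : Nonempty Xpriv := Fintype.card_pos_iff.1 (by omega)
  choose g hg using fun i x =>
    (hsc i x).exists_isStrongSubgradient (hW i).2.2 (hW i).1 (hlip i x) hμ.le hG.le
  obtain ⟨i₀, hi₀⟩ := not_forall.1 htriv
  have hm : 0 < m := i₀.pos
  have hm' : (1 : ℝ) ≤ m := by exact_mod_cast hm
  have : NeZero m := ⟨hm.ne'⟩
  set L := Real.log (1 / δ) with hL
  set κ := Real.log (Fintype.card Xpriv) with hκ
  set Λ := 1 + Real.log m with hΛ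
  have hΛ1 : 1 ≤ Λ := by linarith [Real.log_nonneg hm']
  have hL0 : 0 < L := hε.trans hεδ
  set α := √(14 * G ^ 2 * Λ * √(κ * L) / (ε * n)) with hαdef
  have hκL : 0 < √(κ * L) := Real.sqrt_pos.2 (by positivity)
  have hrad : 0 < 14 * G ^ 2 * Λ * √(κ * L) / (ε * n) := by positivity
  have hα : 0 < α := Real.sqrt_pos.2 hrad
  have hα2 : α ^ 2 = 14 * G ^ 2 * Λ * √(κ * L) / (ε * n) := Real.sq_sqrt hrad.le
  have hrhs : 7 * α ^ 2 / μ ≤ 1000 * (G ^ 2 / μ * (√(κ * L) *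
      (Real.log (max 2 (m * n * lam / μ)) + Real.log (max 1 (Real.log (G / μ))) + Real.log κ +
        Real.log (max 1 (√L / ε)))) / (ε * n)) := by
    have hμlam : μ ≤ lam := by
      obtain ⟨w, hw, w', hw', hne⟩ := Set.not_subsingleton_iff.1 hi₀
      exact (hg i₀ (x₀, Classical.arbitrary Xpriv)).le_of_ne hw hw' hne
    have hsum := one_add_log_le (A := Real.log (G / μ)) (B := √L / ε) hm hn hk hμ hμlam
    rw [hα2]
    set B := Real.log (max 2 (m * n * lam / μ)) + Real.log (max 1 (Real.log (G / μ))) +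
      Real.log κ + Real.log (max 1 (√L / ε))
    calc _ = 98 * (G ^ 2 / μ * (√(κ * L) * Λ) / (ε * n)) := by
          field_simp
          norm_num
      _ ≤ 98 * (G ^ 2 / μ * (√(κ * L) * (7 * B)) / (ε * n)) := by gcongr
      _ = 686 * (G ^ 2 / μ * (√(κ * L) * B) / (ε * n)) := by ring
      _ ≤ _ := by
          have : 0 < B := by linarith
          gcongr
          norm_num
  -- If `G < α`, the a priori bound `G ^ 2 / (2 * μ)` is already below the target.
  rcases lt_or_ge G α with hGα | hαG
  · refine exists_const_mechanism hε (fun _ i => ⟨w₀ i, hw₀ i⟩) (fun _ _ _ => rfl)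
      fun D i => (hbound D i _ (hw₀ i)).trans (le_trans ?_ hrhs)
    have := pow_le_pow_left₀ hG.le hGα.le 2
    rw [div_le_div_iff₀ (by positivity) hμ]
    nlinarith [mul_le_mul_of_nonneg_right this hμ.le, mul_pos (pow_pos hα 2) hμ]
  set T := ⌈G ^ 2 * κ / α ^ 2⌉₊ with hTdef
  have hTpos : 0 < G ^ 2 * κ / α ^ 2 := by positivity
  have hT0 : 0 < T := Nat.ceil_pos.2 hTpos
  have hT1 : G ^ 2 * κ ≤ T * α ^ 2 := by
    rw [← div_le_iff₀ (by positivity)]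
    exact Nat.le_ceil _
  have hbudget := privacy_budget_le hG hα hΛ1 hk' hε hεδ.le hn' hαG hα2
    (Nat.ceil_lt_add_one hTpos.le).le
  -- The moment order `2 * L / ε` pays for `log δ = -L` and leaves a budget of `L`.
  have hlogδ : Real.log δ + 2 * L / ε * ε = L := by
    rw [div_mul_cancel₀ _ hε.ne', hL, one_div, Real.log_inv]
    ring
  -- Neighbors share their public parts, so the mechanism may depend on these arbitrarily.
  choose A hA hAutil using fun pub : Fin n → Xpub =>
    exists_private_minimizer (f := fun i j z w => l i w (pub j, z))
      (g := fun i j z => g i (pub j, z)) hn hT0 hG hμ hW (fun i j z => hg i (pub j, z)) hα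
      (one_pos.trans_le hΛ1) (by positivity : 0 ≤ 2 * L / ε) hδ (by linarith) hT1
      (hbudget.trans_eq hlogδ.symm)
  refine ⟨fun D => A (fun j => (D j).1) (fun j => (D j).2), ?_, fun D i => ?_⟩
  · rintro D D' ⟨hpub, j₀, hpriv⟩ S hS
    have e : (fun j => (D j).1) = fun j => (D' j).1 := funext hpub
    simp only [e]
    exact hA _ _ _ ⟨j₀, hpriv⟩ S hS
  · have h := hAutil (fun j => (D j).1) (fun j => (D j).2) i (v D i) (hv D i)
    simp only [hexc]
    exact ⟨h.1, h.2.trans hrhs⟩
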